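/- Let $a>0$, $l,l'\ge 3/2$, $\alpha\in\mathbb R$, $m\in\mathbb N_0$, $\lambda=1/a$, $2\rho=l+l'$, and let $W(x;l,l')=-\frac1{2a}\left[l\cot\frac{x}{2a}-l'\tan\frac{x}{2a}\right]$ on $(0,\pi a)$ be the superpotential of the Pöschl–Teller potential of the first kind $W^2-W'=\frac1{4a^2}\left[\frac{l(l-1)}{\sin^2(x/2a)}+\frac{l'(l'-1)}{\cos^2(x/2a)}-(l+l')^2\right]$. Put $a_s=(l+s-1,l'+s-1)$, $\mathcal R(a_s)=\lambda^2(l+l'+2s-1)$, $E_n=\sum_{k=1}^n\mathcal R(a_k)$. Let $\Psi_n$ be the normalized eigenfunctions in $L^2((0,\pi a),dx)$: $\Psi_0(x;a_1)=C\sin^l\frac{x}{2a}\cos^{l'}\frac{x}{2a}$ with $C>0$ and $\|\Psi_0\|=1$, and $\Psi_{n+1}(\cdot;a_1)=E_{n+1}^{-1/2}\left(-\frac{d}{dx}+W(\cdot;a_1)\right)\Psi_n(\cdot;a_2)$. Let $\mathfrak H_m$ be the closed span of $\{\Psi_{n+m}\}_{n\ge0}$. With $\mathcal Z_j=e^{-i\alpha\mathcal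 R(a_1)}$, hence $\mathcal Z_{j+k}=e^{-i\alpha\mathcal R(a_{1+k})}$, let $$K_n^m=\frac{\left[\prod_{k=m+1}^{n+m}\sum_{s=k}^{n+m}\mathcal R(a_s)\right]^{1/2}}{\prod_{k=m}^{n+m-1}\mathcal Z_{j+k}\,\left[\prod_{k=1}^{m}\sum_{s=k}^{n+m}\mathcal R(a_s)\right]^{1/2}},\qquad \mathcal N_m(x)=\Big(\sum_{n\ge0}\frac{x^n}{|K_n^m|^2}\Big)^{-1/2},$$ and let $|z\rangle_m=\mathcal N_m(|z|^2)\sum_{n\ge0}\frac{z^n}{K_n^m}\,\Psi_{n+m}$, $z\in\mathbb C$, be the photon-added coherent states. For $x>0$ let $$\omega_m(x)=\frac{1}{2\pi\sqrt\pi}\,\frac{x^{m}}{\mathcal N_m(x)^2}\,\lambda^{-2(1+2m)}\,2^{2(\rho-1)}\,G^{5,0}_{3,5}\!\left(\frac{a^2x}{4}\,\middle|\,{0,\,-1+2\rho+m,\,-1+2\rho+m\atop -m,\,-m,\,2\rho-1,\,-1+\rho,\,-\frac12+\rho}\right),$$ where $G^{5,0}_{3,5}(y)=\frac1{2\pi i}\int_{c-i\infty}^{c+i\infty}\frac{\prod_{j=1}^5\Gamma(b_j+s)}{\prod_{j=1}^3\Gamma(a_j+s)}\,y^{-s}\,ds$,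 with $a_j$, $b_j$ the upper and lower parameters displayed (this $a_j$ is not the $a_s$ above), on any vertical line with all poles of the numerator to its left, that is, $c>-b_j$ for all $j$. Then the $\Psi_n$ are orthonormal; both series converge for every $z\in\mathbb C$, and $|z\rangle_m$ is a unit vector of $\mathfrak H_m$; the integral defining $G$ converges absolutely; $\omega_m(x)$ is real and positive for $x>0$; the function $g_m(x)=\pi\mathcal N_m(x)^2x^{-m}\omega_m(x)$ solves the Stieltjes moment problem $$\int_0^\infty x^{n+m}g_m(x)\,dx=|K_n^m|^2=\lambda^{2(n-m)}\frac{2^{2n+2m+2\rho}}{2\sqrt\pi}\,\frac{\Gamma(n+1)^2\,\Gamma(n+m+2\rho)\,\Gamma(n+m+\rho)\,\Gamma(n+m+\rho+\frac12)}{\Gamma(n+m+1)\,\Gamma(n+2m+2\rho)^2}\qquad(n\ge0),$$ with absolutely convergent integrals; and the states resolve the identity of $\mathfrak H_m$, $$\int_{\mathbb C}d^2z\;|z\rangle_m\,\omega_m(|z|^2)\,{}_m\langle z|=\mathbf 1_{\mathfrak H_m},$$ in the weak sense: for all $f,g\in L^2((0,\pi a))$ the function $\omega_m(|z|^2)\,\langle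 f|z\rangle_m\,{}_m\langle z|g\rangle$ is integrable over $\mathbb C$ with integral $\langle f,P_mg\rangle$, where $P_m$ is the orthogonal projection onto $\mathfrak H_m$. -/

import Mathlib

open MeasureTheory Set
open scoped InnerProductSpace

noncomputable section

/-! ### The Meijer G-function -/

/-- The Mellin--Barnes kernel
`∏_{b ∈ bUp} Γ(b+s) ∏_{a ∈ aUp} Γ(1-a-s) / (∏_{b ∈ bLow} Γ(1-b-s) ∏_{a ∈ aLow} Γ(a+s))`.
(Mathlib's `Γ` vanishes at its poles, so the quotient vanishes at the poles of the denominator,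
as it should.) -/
def meijerKernel (aUp aLow bUp bLow : List ℂ) (s : ℂ) : ℂ :=
  ((bUp.map fun b => Complex.Gamma (b + s)).prod *
      (aUp.map fun a => Complex.Gamma (1 - a - s)).prod) /
    ((bLow.map fun b => Complex.Gamma (1 - b - s)).prod *
      (aLow.map fun a => Complex.Gamma (a + s)).prod)

/-- The vertical line `Re s = c` separates the poles of the factors `Γ(b+s)`, `b ∈ bUp`, (to the
left of the line) from the poles of the factors `Γ(1-a-s)`, `a ∈ aUp`, (to the right of it). -/
def MeijerSeparates (aUp bUp : List ℂ) (c : ℝ) : Prop :=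
  (∀ b ∈ bUp, -b.re < c) ∧ ∀ a ∈ aUp, c < 1 - a.re

/-- The Meijer G-function `G^{μ,ν}_{p,q}(x | aUp ; aLow / bUp ; bLow)`, `μ = |bUp|`, `ν = |aUp|`,
`p = |aUp| + |aLow|`, `q = |bUp| + |bLow|`, at `x > 0`: the Mellin--Barnes integral
`(1/(2πi)) ∫ kernel(s) x^{-s} ds` along the line `Re s = c`, for `c` as in `MeijerSeparates`. -/
def meijerG (aUp aLow bUp bLow : List ℂ) (c : ℝ) (x : ℝ) : ℂ :=
  mellinInv c (meijerKernel aUp aLow bUp bLow) x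

/-! ### Pöschl--Teller potentials of the first type -/

/-- The superpotential `W(x; l, l') = -(1/2a) [l cot (x/2a) - l' tan (x/2a)]`. -/
def ptW (a l l' x : ℝ) : ℝ :=
  -(1 / (2 * a)) * (l * Real.cot (x / (2 * a)) - l' * Real.tan (x / (2 * a)))

/-- The remainder `R(a_s)` of the shape invariance condition: `R(l, l') = (l + l' + 1) / a²`,
at `a_s = (l + s - 1, l' + s - 1)`. -/
def ptR (a l l' : ℝ) (s : ℕ) : ℝ :=
  (1 / a ^ 2) * ((l + ((s : ℝ) - 1)) + (l' + ((s : ℝ) - 1)) + 1)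

/-- The energy `E_n = ∑_{k=1}^n R(a_k)`. -/
def ptEnergy (a l l' : ℝ) (n : ℕ) : ℝ :=
  ∑ k ∈ Finset.Icc 1 n, ptR a l l' k

/-- The normalized eigenfunctions of the Pöschl--Teller Hamiltonian
`-d²/dx² + W² - W'` on `(0, πa)`, with
`W² - W' = (1/4a²) [l(l-1)/sin²(x/2a) + l'(l'-1)/cos²(x/2a) - (l+l')²]`:
the ground state is `c sin^l (x/2a) cos^{l'} (x/2a)`, and
`Ψ_{n+1}(·; a₁) = E_{n+1}(a₁)^{-1/2} A†(a₁) Ψ_n(·; a₂)`, with `A†(a₁) = -d/dx + W(·; a₁)`,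
`a₁ = (l, l')`, `a₂ = (l+1, l'+1)`. -/
def ptPsi (a : ℝ) : ℕ → ℝ → ℝ → ℝ → ℝ
  | 0, l, l', x =>
      (∫ y in Ioo 0 (Real.pi * a),
          (Real.sin (y / (2 * a)) ^ l * Real.cos (y / (2 * a)) ^ l') ^ 2) ^ (-(1 / 2) : ℝ) *
        (Real.sin (x / (2 * a)) ^ l * Real.cos (x / (2 * a)) ^ l')
  | n + 1, l, l', x =>
      (ptEnergy a l l' (n + 1)) ^ (-(1 / 2) : ℝ) *
        (-(deriv (ptPsi a n (l + 1) (l' + 1)) x) + ptW a l l' x * ptPsi a n (l + 1) (l' + 1) x)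

lemma ptPsi_form (a : ℝ) (ha : 0 < a) (n : ℕ) : ∀ l l' : ℝ, ∃ Q : Polynomial ℝ,
    ∀ x ∈ Ioo 0 (Real.pi * a), ptPsi a n l l' x =
      Real.sin (x / (2 * a)) ^ l * Real.cos (x / (2 * a)) ^ l' *
        Q.eval (Real.sin (x / (2 * a)) ^ 2) := by
  induction n with
  | zero =>
    intro l l'
    refine ⟨Polynomial.C ((∫ y in Ioo 0 (Real.pi * a),
          (Real.sin (y / (2 * a)) ^ l * Real.cos (y / (2 * a)) ^ l') ^ 2) ^ (-(1 / 2) : ℝ)), ?_⟩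
    intro x _
    simp only [ptPsi, Polynomial.eval_C]
    ring
  | succ n ih =>
    intro l l'
    obtain ⟨Q, hQ⟩ := ih (l + 1) (l' + 1)
    refine ⟨Polynomial.C ((ptEnergy a l l' (n + 1)) ^ (-(1 / 2) : ℝ) * (-(1 / (2 * a)))) *
      (Polynomial.C (2 * l + 1) * (1 - Polynomial.X) * Q
        - Polynomial.C (2 * l' + 1) * Polynomial.X * Q
        + Polynomial.C 2 * Polynomial.X * (1 - Polynomial.X) * Polynomial.derivative Q), ?_⟩
    intro x hx
    have hu0 : 0 < x / (2 * a) := div_pos hx.1 (by positivity)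
    have hu1 : x / (2 * a) < Real.pi / 2 := by
      rw [div_lt_div_iff₀ (by positivity) (by norm_num)]
      nlinarith [hx.2]
    have hs : 0 < Real.sin (x / (2 * a)) :=
      Real.sin_pos_of_pos_of_lt_pi hu0 (by linarith [Real.pi_pos])
    have hc : 0 < Real.cos (x / (2 * a)) :=
      Real.cos_pos_of_mem_Ioo ⟨by linarith [Real.pi_pos], hu1⟩
    have hev : ptPsi a n (l + 1) (l' + 1) =ᶠ[nhds x] fun x =>
        Real.sin (x / (2 * a)) ^ (l + 1) * Real.cos (x / (2 * a)) ^ (l' + 1) *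
        Q.eval (Real.sin (x / (2 * a)) ^ 2) :=
      Filter.eventuallyEq_of_mem (isOpen_Ioo.mem_nhds hx) hQ
    have hd : HasDerivAt (fun y : ℝ => y / (2 * a)) (1 / (2 * a)) x :=
      (hasDerivAt_id x).div_const _
    have hsin : HasDerivAt (fun y : ℝ => Real.sin (y / (2 * a)))
        (Real.cos (x / (2 * a)) * (1 / (2 * a))) x := hd.sin
    have hcos : HasDerivAt (fun y : ℝ => Real.cos (y / (2 * a)))
        (-Real.sin (x / (2 * a)) * (1 / (2 * a))) x := hd.cos
    have h1 := hsin.rpow_const (p := l + 1) (Or.inl hs.ne')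
    have h2 := hcos.rpow_const (p := l' + 1) (Or.inl hc.ne')
    have h3 : HasDerivAt (fun y : ℝ => Q.eval (Real.sin (y / (2 * a)) ^ 2))
        (Q.derivative.eval (Real.sin (x / (2 * a)) ^ 2) *
          (((2 : ℕ) : ℝ) * Real.sin (x / (2 * a)) ^ (2 - 1) *
            (Real.cos (x / (2 * a)) * (1 / (2 * a))))) x :=
      (Q.hasDerivAt (Real.sin (x / (2 * a)) ^ 2)).comp x
        (h := fun y : ℝ => Real.sin (y / (2 * a)) ^ 2) (hsin.pow 2)
    have h4 := (h1.mul h2).mul h3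
    simp only [ptPsi]
    rw [hev.deriv_eq, hQ x hx]
    have h5 := h4.deriv
    simp only [Pi.mul_def] at h5
    rw [h5]
    simp only [ptW, Real.cot_eq_cos_div_sin, Real.tan_eq_sin_div_cos, add_sub_cancel_right,
      Real.rpow_add hs, Real.rpow_add hc, Real.rpow_one, Polynomial.eval_mul, Polynomial.eval_C,
      Polynomial.eval_add, Polynomial.eval_sub, Polynomial.eval_one, Polynomial.eval_X]
    have hcs : Real.cos (x / (2 * a)) ^ 2 = 1 - Real.sin (x / (2 * a)) ^ 2 := by
      have := Real.sin_sq_add_cos_sq (x / (2 * a)); linarith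
    rw [← hcs]
    field_simp
    push_cast
    ring

lemma ptPsi_memLp (a : ℝ) (ha : 0 < a) {l l' : ℝ} (hl : 3 / 2 ≤ l) (hl' : 3 / 2 ≤ l') (n : ℕ) :
    MemLp (fun x => (ptPsi a n l l' x : ℂ)) 2 (volume.restrict (Ioo 0 (Real.pi * a))) := by
  obtain ⟨Q, hQ⟩ := ptPsi_form a ha n l l'
  have hcont : Continuous fun x : ℝ => ((Real.sin (x / (2 * a)) ^ l *
      Real.cos (x / (2 * a)) ^ l' * Q.eval (Real.sin (x / (2 * a)) ^ 2) : ℝ) : ℂ) := by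
    refine Complex.continuous_ofReal.comp ((Continuous.mul ?_ ?_).mul ?_)
    · exact (Real.continuous_sin.comp (continuous_id.div_const _)).rpow_const
        fun _ => Or.inr (by linarith)
    · exact (Real.continuous_cos.comp (continuous_id.div_const _)).rpow_const
        fun _ => Or.inr (by linarith)
    · exact Q.continuous.comp ((Real.continuous_sin.comp (continuous_id.div_const _)).pow 2)
  have h1 : MemLp (fun x : ℝ => ((Real.sin (x / (2 * a)) ^ l *
      Real.cos (x / (2 * a)) ^ l' * Q.eval (Real.sin (x / (2 * a)) ^ 2) : ℝ) : ℂ)) 2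
      (volume.restrict (Ioo 0 (Real.pi * a))) := by
    obtain ⟨C, hC⟩ := (isCompact_Icc (a := (0 : ℝ)) (b := Real.pi * a)).exists_bound_of_continuousOn
      hcont.continuousOn
    refine MemLp.of_bound hcont.aestronglyMeasurable C ?_
    filter_upwards [ae_restrict_mem measurableSet_Ioo] with x hx
    exact hC x (Ioo_subset_Icc_self hx)
  refine h1.ae_eq ?_
  filter_upwards [ae_restrict_mem measurableSet_Ioo] with x hx
  rw [hQ x hx]

/-- The Hilbert space `L²((0, πa), dx)`. -/
abbrev PTHilbert (a : ℝ) : Type := Lp ℂ 2 (volume.restrict (Ioo 0 (Real.pi * a)))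

/-- The normalized eigenstate `|Ψ_n⟩` as an element of `L²((0, πa), dx)`. -/
def ptState {a l l' : ℝ} (ha : 0 < a) (hl : 3 / 2 ≤ l) (hl' : 3 / 2 ≤ l') (n : ℕ) : PTHilbert a :=
  (ptPsi_memLp a ha hl hl' n).toLp _

/-- The closed subspace `𝔥_m` spanned by the states `|Ψ_{n+m}⟩`, `n ≥ 0`. -/
def ptSubspace {a l l' : ℝ} (ha : 0 < a) (hl : 3 / 2 ≤ l) (hl' : 3 / 2 ≤ l') (m : ℕ) :
    Submodule ℂ (PTHilbert a) :=
  (Submodule.span ℂ (range fun n : ℕ => ptState ha hl hl' (n + m))).topologicalClosure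

instance {a l l' : ℝ} (ha : 0 < a) (hl : 3 / 2 ≤ l) (hl' : 3 / 2 ≤ l') (m : ℕ) :
    (ptSubspace ha hl hl' m).HasOrthogonalProjection :=
  haveI : CompleteSpace (ptSubspace ha hl hl' m) :=
    (Submodule.isClosed_topologicalClosure _).completeSpace_coe
  inferInstance

/-! ### Photon-added coherent states -/

/-- The functional `Z_{j+k}` for the choice `Z_j = e^{-iα R(a_1)}`; raising the index by `k`
replaces `a_1` by `a_{1+k}`. -/
def ptZ (a l l' α : ℝ) (k : ℕ) : ℂ :=
  Complex.exp (-Complex.I * α * ptR a l l' (1 + k))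

/-- The expansion coefficient
`K_n^m = (∏_{k=m+1}^{n+m} ∑_{s=k}^{n+m} R(a_s))^{1/2} /
  (∏_{k=m}^{n+m-1} Z_{j+k} · (∏_{k=1}^m ∑_{s=k}^{n+m} R(a_s))^{1/2})`. -/
def ptK (a l l' α : ℝ) (m n : ℕ) : ℂ :=
  (Real.sqrt (∏ k ∈ Finset.Icc (m + 1) (n + m), ∑ s ∈ Finset.Icc k (n + m), ptR a l l' s) : ℂ) /
    ((∏ k ∈ Finset.Ico m (n + m), ptZ a l l' α k) *
      (Real.sqrt (∏ k ∈ Finset.Icc 1 m, ∑ s ∈ Finset.Icc k (n + m), ptR a l l' s) : ℂ))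

/-- The normalization constant `N_m(x) = (∑_n x^n / |K_n^m|²)^{-1/2}`, `x = |z|²`. -/
def ptN (a l l' α : ℝ) (m : ℕ) (x : ℝ) : ℝ :=
  (∑' n : ℕ, x ^ n / ‖ptK a l l' α m n‖ ^ 2) ^ (-(1 / 2) : ℝ)

/-- The photon-added coherent state `|z⟩_m = N_m(|z|²) ∑_n (z^n / K_n^m) |Ψ_{n+m}⟩`. -/
def ptCoherent {a l l' : ℝ} (ha : 0 < a) (hl : 3 / 2 ≤ l) (hl' : 3 / 2 ≤ l') (α : ℝ) (m : ℕ)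
    (z : ℂ) : PTHilbert a :=
  (ptN a l l' α m (‖z‖ ^ 2) : ℂ) •
    ∑' n : ℕ, (z ^ n / ptK a l l' α m n) • ptState ha hl hl' (n + m)

/-! ### The weight function -/

/-- The parameters `0, -1+2ρ+m, -1+2ρ+m` in the upper row of `G^{5,0}_{3,5}`. -/
def ptTop (ρ : ℝ) (m : ℕ) : List ℂ := [0, -1 + 2 * ρ + m, -1 + 2 * ρ + m]

/-- The parameters `-m, -m, 2ρ-1, -1+ρ, -1/2+ρ` in the lower row of `G^{5,0}_{3,5}`. -/
def ptBottom (ρ : ℝ) (m : ℕ) : List ℂ := [-m, -m, 2 * ρ - 1, -1 + ρ, -(1 / 2) + ρ]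

/-- The weight `ω_m(x)`, `x = |z|²`, with `λ = 1/a` and `ρ = (l+l')/2`:
`(1/(2π√π)) x^m N_m(x)^{-2} λ^{-2(1+2m)} 2^{2(ρ-1)} G^{5,0}_{3,5}(a² x / 4 | …)`,
the G-function being computed along the line `Re s = c`. -/
def ptWeight (a l l' α : ℝ) (m : ℕ) (c : ℝ) (x : ℝ) : ℂ :=
  ((1 / (2 * Real.pi * Real.sqrt Real.pi) * (x ^ m / ptN a l l' α m x ^ 2) *
      (1 / a) ^ (-(2 * (1 + 2 * (m : ℤ)))) * (2 : ℝ) ^ (2 * ((l + l') / 2 - 1)) : ℝ) : ℂ) *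
    meijerG [] (ptTop ((l + l') / 2) m) (ptBottom ((l + l') / 2) m) [] c (a ^ 2 * x / 4)

/-- The function `g_m(x) = π N_m(x)² x^{-m} ω_m(x)`. -/
def ptG (a l l' α : ℝ) (m : ℕ) (c : ℝ) (x : ℝ) : ℂ :=
  ((Real.pi * ptN a l l' α m x ^ 2 * (x ^ m)⁻¹ : ℝ) : ℂ) * ptWeight a l l' α m c x

end

/-! Orthonormality is supersymmetric quantum mechanics in polynomial form. With `Ψ_n = sin^l
cos^{l'} Q(sin²)`, the raising operator `A†` becomes `ptRaise` and the lowering operator `A` becomes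
differentiation of `Q`, up to constants. Shape invariance is the commutation rule
`derivative_ptRaise`, adjointness is one integration by parts (`integral_mul_ptRaise`), and
induction on the level gives `integral_ptPsi_mul_ptPsi`.

The partial sums of `R(a_s)` factor linearly and the phases have modulus one, so `|K_n^m|²` is a
quotient of Gamma values (`norm_sq_ptK_eq`). It grows like a squared factorial or faster, hence
every series converges.

The core is the positivity of the G-function. Its kernel splits into three quotients
`Γ(s+b)/Γ(s+b+β)` with `β ≥ 0`, times `Γ(s+ρ-1) Γ(s+ρ-1/2)`. By the duplication formula the last
product is the Mellin transform of `√π x^{ρ-1} e^{-2√x}`. Each quotient is a normalized Beta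
integral, realized by an Erdélyi–Kober fractional integral, whose kernel is positive. So the kernel
is the Mellin transform of a positive continuous `H` (`exists_mellin_eq_meijerKernel`), and Mellin
inversion identifies the G-function with `H` at every `x > 0` (`meijerG_eq`). The moments are then
values of this Mellin transform at the integers `n+m+1` (`moment_weight`).

For the resolution of the identity, the functions `√ω_m N_m z^n/K_n^m` are orthonormal in `L²(ℂ)`:
off the diagonal by rotation invariance, on it by the moments. Since `√ω_m ⟨f|z⟩` is the expansion
in these functions with coefficients `⟨f, Ψ_{n+m}⟩`, Parseval turns the integral over `ℂ` into `∑
⟨f, Ψ_{n+m}⟩⟨Ψ_{n+m}, g⟩ = ⟨f, P_m g⟩`. -/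

/-! ### Eigenfunctions: polynomial factors and orthonormality -/

open Polynomial in
/-- The action of `-2a A†(l, l')` on the polynomial factor of `sin^{l+1} cos^{l'+1} Q(sin²)`. -/
noncomputable def ptRaise (l l' : ℝ) (Q : ℝ[X]) : ℝ[X] :=
  C (2 * l + 1) * (1 - X) * Q - C (2 * l' + 1) * X * Q + C 2 * X * (1 - X) * derivative Q

open Polynomial in
/-- The polynomial `Q` with `Ψ_n(x; l, l') = sin^l cos^{l'} Q(sin²)` at `x/(2a)`. -/
noncomputable def ptPoly (a : ℝ) : ℕ → ℝ → ℝ → ℝ[X]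
  | 0, l, l' => C ((∫ y in Ioo 0 (Real.pi * a),
          (Real.sin (y / (2 * a)) ^ l * Real.cos (y / (2 * a)) ^ l') ^ 2) ^ (-(1 / 2) : ℝ))
  | n + 1, l, l' => C ((ptEnergy a l l' (n + 1)) ^ (-(1 / 2) : ℝ) * (-(1 / (2 * a)))) *
      ptRaise l l' (ptPoly a n (l + 1) (l' + 1))

lemma pt_sin_pos {a x : ℝ} (ha : 0 < a) (hx : x ∈ Ioo 0 (Real.pi * a)) :
    0 < Real.sin (x / (2 * a)) := by
  have hu1 : x / (2 * a) < Real.pi := by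
    rw [div_lt_iff₀ (by positivity)]
    nlinarith [hx.2, Real.pi_pos]
  exact Real.sin_pos_of_pos_of_lt_pi (div_pos hx.1 (by positivity)) hu1

lemma pt_cos_pos {a x : ℝ} (ha : 0 < a) (hx : x ∈ Ioo 0 (Real.pi * a)) :
    0 < Real.cos (x / (2 * a)) := by
  have hu0 : 0 < x / (2 * a) := div_pos hx.1 (by positivity)
  have hu1 : x / (2 * a) < Real.pi / 2 := by
    rw [div_lt_div_iff₀ (by positivity) (by norm_num)]
    nlinarith [hx.2]
  exact Real.cos_pos_of_mem_Ioo ⟨by linarith [Real.pi_pos], hu1⟩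

lemma hasDerivAt_sin_rpow_mul_cos_rpow_mul_eval {a x : ℝ} (ha : 0 < a)
    (hx : x ∈ Ioo 0 (Real.pi * a)) (p q : ℝ) (Q : Polynomial ℝ) :
    HasDerivAt (fun x => Real.sin (x / (2 * a)) ^ (p + 1) * Real.cos (x / (2 * a)) ^ (q + 1) *
        Q.eval (Real.sin (x / (2 * a)) ^ 2))
      (1 / (2 * a) * (Real.sin (x / (2 * a)) ^ p * Real.cos (x / (2 * a)) ^ q *
        (Polynomial.C (p + 1) * (1 - Polynomial.X) * Q - Polynomial.C (q + 1) * Polynomial.X * Q +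
          Polynomial.C 2 * Polynomial.X * (1 - Polynomial.X) * Polynomial.derivative Q).eval
            (Real.sin (x / (2 * a)) ^ 2))) x := by
  have hs := pt_sin_pos ha hx
  have hc := pt_cos_pos ha hx
  have hd : HasDerivAt (fun y : ℝ => y / (2 * a)) (1 / (2 * a)) x :=
    (hasDerivAt_id x).div_const _
  have hsin : HasDerivAt (fun y : ℝ => Real.sin (y / (2 * a)))
      (Real.cos (x / (2 * a)) * (1 / (2 * a))) x := hd.sin
  have hcos : HasDerivAt (fun y : ℝ => Real.cos (y / (2 * a)))
      (-Real.sin (x / (2 * a)) * (1 / (2 * a))) x := hd.cos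
  have h1 := hsin.rpow_const (p := p + 1) (Or.inl hs.ne')
  have h2 := hcos.rpow_const (p := q + 1) (Or.inl hc.ne')
  have h3 : HasDerivAt (fun y : ℝ => Q.eval (Real.sin (y / (2 * a)) ^ 2))
      (Q.derivative.eval (Real.sin (x / (2 * a)) ^ 2) *
        (((2 : ℕ) : ℝ) * Real.sin (x / (2 * a)) ^ (2 - 1) *
          (Real.cos (x / (2 * a)) * (1 / (2 * a))))) x :=
    (Q.hasDerivAt (Real.sin (x / (2 * a)) ^ 2)).comp x
      (h := fun y : ℝ => Real.sin (y / (2 * a)) ^ 2) (hsin.pow 2)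
  refine ((h1.mul h2).mul h3).congr_deriv ?_
  simp only [Pi.mul_apply, add_sub_cancel_right,
    Real.rpow_add hs, Real.rpow_add hc, Real.rpow_one, Polynomial.eval_mul, Polynomial.eval_C,
    Polynomial.eval_add, Polynomial.eval_sub, Polynomial.eval_one, Polynomial.eval_X]
  have hcs : Real.cos (x / (2 * a)) ^ 2 = 1 - Real.sin (x / (2 * a)) ^ 2 := by
    have := Real.sin_sq_add_cos_sq (x / (2 * a)); linarith
  rw [← hcs]
  field_simp
  push_cast
  ring

lemma ptPsi_eq_ptPoly {a : ℝ} (ha : 0 < a) (n : ℕ) : ∀ l l' : ℝ, ∀ x ∈ Ioo 0 (Real.pi * a),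
    ptPsi a n l l' x = Real.sin (x / (2 * a)) ^ l * Real.cos (x / (2 * a)) ^ l' *
      (ptPoly a n l l').eval (Real.sin (x / (2 * a)) ^ 2) := by
  induction n with
  | zero =>
    intro l l' x _
    simp only [ptPsi, ptPoly, Polynomial.eval_C]
    ring
  | succ n ih =>
    intro l l' x hx
    have hs := pt_sin_pos ha hx
    have hc := pt_cos_pos ha hx
    have hev : ptPsi a n (l + 1) (l' + 1) =ᶠ[nhds x] _ :=
      Filter.eventuallyEq_of_mem (isOpen_Ioo.mem_nhds hx) (ih (l + 1) (l' + 1))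
    simp only [ptPsi]
    rw [hev.deriv_eq, (hasDerivAt_sin_rpow_mul_cos_rpow_mul_eval ha hx l l' _).deriv, ih _ _ x hx]
    simp only [ptPoly, ptRaise, ptW, Real.cot_eq_cos_div_sin, Real.tan_eq_sin_div_cos,
      Real.rpow_add hs, Real.rpow_add hc, Real.rpow_one, Polynomial.eval_mul, Polynomial.eval_C,
      Polynomial.eval_add, Polynomial.eval_sub, Polynomial.eval_one, Polynomial.eval_X]
    have hcs : Real.cos (x / (2 * a)) ^ 2 = 1 - Real.sin (x / (2 * a)) ^ 2 := by
      have := Real.sin_sq_add_cos_sq (x / (2 * a)); linarith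
    rw [← hcs]
    field_simp
    ring

lemma ptEnergy_eq (a l l' : ℝ) (n : ℕ) : ptEnergy a l l' n = 1 / a ^ 2 * (n * (l + l' + n)) := by
  unfold ptEnergy
  induction n with
  | zero => simp
  | succ n ih =>
    rw [Finset.sum_Icc_succ_top (by omega), ih, ptR]
    push_cast
    ring

-- Shape invariance `A(a₁) A†(a₁) = A†(a₂) A(a₂) + R(a₁)`: here `ptRaise` stands for `-2a A†` and
-- `derivative` for `a A`, which accounts for the factor `-2a²` in front of `R(a₁) = (l+l'+1)/a²`.
open Polynomial in
lemma derivative_ptRaise (l l' : ℝ) (Q : ℝ[X]) :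
    derivative (ptRaise l l' Q) =
      ptRaise (l + 1) (l' + 1) (derivative Q) - C (2 * (l + l' + 1)) * Q := by
  simp only [ptRaise, derivative_mul, derivative_C, derivative_X, derivative_add, derivative_sub,
    derivative_one, C_add, C_mul, C_1]
  have h2 : (C 2 : ℝ[X]) = 2 := rfl
  rw [h2]
  ring

open Polynomial in
lemma ptRaise_C_mul (l l' t : ℝ) (Q : ℝ[X]) : ptRaise l l' (C t * Q) = C t * ptRaise l l' Q := by
  simp only [ptRaise, derivative_C_mul]
  ring

-- The eigenvalue equation `A A† Ψ_n(a₂) = E_{n+1}(a₁) Ψ_n(a₂)`. Shape invariance reduces it to the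
-- previous level at shifted parameters, where the energies add up: `E_{n+2}(a₁) = E_{n+1}(a₂) +
-- R(a₁)`.
open Polynomial in
lemma derivative_ptRaise_ptPoly {a : ℝ} (ha : 0 < a) (n : ℕ) : ∀ l l' : ℝ,
    derivative (ptRaise l l' (ptPoly a n (l + 1) (l' + 1))) =
      C (-(2 * a ^ 2 * ptEnergy a l l' (n + 1))) * ptPoly a n (l + 1) (l' + 1) := by
  induction n with
  | zero =>
    intro l l'
    rw [derivative_ptRaise]
    simp only [ptPoly, derivative_C, ptEnergy_eq]
    simp only [ptRaise, mul_zero, derivative_zero, sub_zero, add_zero, zero_sub, zero_add]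
    rw [← neg_mul, ← C_neg]
    congr 2
    field_simp
    simp
  | succ n ih =>
    intro l l'
    rw [derivative_ptRaise]
    have h : derivative (ptPoly a (n + 1) (l + 1) (l' + 1)) =
        C (-(2 * a ^ 2 * ptEnergy a (l + 1) (l' + 1) (n + 1)) *
          ((ptEnergy a (l + 1) (l' + 1) (n + 1)) ^ (-(1 / 2) : ℝ) * (-(1 / (2 * a))))) *
          ptPoly a n (l + 1 + 1) (l' + 1 + 1) := by
      rw [ptPoly, derivative_C_mul, ih, C_mul (a := -(2 * a ^ 2 * _))]
      ring
    rw [h, ptRaise_C_mul, C_mul, mul_assoc]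
    rw [← ptPoly, ← sub_mul, ← C_sub]
    congr 2
    simp only [ptEnergy_eq]
    push_cast
    field_simp
    ring

lemma continuous_sin_rpow_mul_cos_rpow_mul_eval (a : ℝ) {p q : ℝ} (hp : 0 ≤ p) (hq : 0 ≤ q)
    (Q : Polynomial ℝ) :
    Continuous fun x => Real.sin (x / (2 * a)) ^ p * Real.cos (x / (2 * a)) ^ q *
        Q.eval (Real.sin (x / (2 * a)) ^ 2) := by
  refine Continuous.mul (Continuous.mul ?_ ?_) ?_
  · exact (Real.continuous_sin.comp (continuous_id.div_const _)).rpow_const fun _ => Or.inr hp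
  · exact (Real.continuous_cos.comp (continuous_id.div_const _)).rpow_const fun _ => Or.inr hq
  · exact Q.continuous.comp ((Real.continuous_sin.comp (continuous_id.div_const _)).pow 2)

lemma integrableOn_sin_rpow_mul_cos_rpow_mul_eval (a : ℝ) {p q : ℝ} (hp : 0 ≤ p) (hq : 0 ≤ q)
    (Q : Polynomial ℝ) :
    IntegrableOn (fun x => Real.sin (x / (2 * a)) ^ p * Real.cos (x / (2 * a)) ^ q *
        Q.eval (Real.sin (x / (2 * a)) ^ 2)) (Ioo 0 (Real.pi * a)) :=
  ((continuous_sin_rpow_mul_cos_rpow_mul_eval a hp hq Q).continuousOn.integrableOn_compact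
    (isCompact_Icc (a := 0) (b := Real.pi * a))).mono_set Ioo_subset_Icc_self

/-- `A†(l, l')` is the formal adjoint of `A(l, l')`, in terms of the polynomial factors. -/
lemma integral_mul_ptRaise {a l l' : ℝ} (ha : 0 < a) (hl : 0 < l) (hl' : 0 < l')
    (P Q : Polynomial ℝ) :
    ∫ x in Ioo 0 (Real.pi * a), Real.sin (x / (2 * a)) ^ (2 * l) *
        Real.cos (x / (2 * a)) ^ (2 * l') * (P * ptRaise l l' Q).eval (Real.sin (x / (2 * a)) ^ 2) =
      -2 * ∫ x in Ioo 0 (Real.pi * a), Real.sin (x / (2 * a)) ^ (2 * (l + 1)) *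
        Real.cos (x / (2 * a)) ^ (2 * (l' + 1)) *
          (Polynomial.derivative P * Q).eval (Real.sin (x / (2 * a)) ^ 2) := by
  have hπ : 0 ≤ Real.pi * a := by positivity
  -- The primitive `sin^{2l+1} cos^{2l'+1} (PQ)(sin²)` vanishes at both endpoints. Its derivative
  -- contains `P * ptRaise l l' Q` and the extra term `2X(1-X)P'Q`, whose factor `X(1-X) = sin²
  -- cos²` raises both exponents of the weight by two.
  have hFTC := intervalIntegral.integral_eq_sub_of_hasDerivAt_of_le hπ
    (continuous_sin_rpow_mul_cos_rpow_mul_eval a (p := 2 * l + 1) (q := 2 * l' + 1)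
      (by positivity) (by positivity) (P * Q)).continuousOn
    (fun x hx => hasDerivAt_sin_rpow_mul_cos_rpow_mul_eval ha hx (2 * l) (2 * l') (P * Q))
    ((continuous_const.mul (continuous_sin_rpow_mul_cos_rpow_mul_eval a (by positivity)
      (by positivity) _)).intervalIntegrable _ _)
  have he : Real.pi * a / (2 * a) = Real.pi / 2 := by field_simp
  rw [he, Real.cos_pi_div_two, Real.zero_rpow (by positivity), zero_div, Real.sin_zero,
    Real.zero_rpow (by positivity)] at hFTC
  simp only [mul_zero, zero_mul, sub_zero] at hFTC
  rw [intervalIntegral.integral_const_mul, mul_eq_zero, or_iff_right (by positivity),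
    intervalIntegral.integral_of_le hπ, integral_Ioc_eq_integral_Ioo] at hFTC
  rw [← integral_const_mul, ← sub_eq_zero, ← integral_sub]
  · refine Eq.trans ?_ hFTC
    refine setIntegral_congr_fun measurableSet_Ioo fun x hx => ?_
    have hs := pt_sin_pos ha hx
    have hc := pt_cos_pos ha hx
    have hcs : Real.cos (x / (2 * a)) ^ 2 = 1 - Real.sin (x / (2 * a)) ^ 2 := by
      have := Real.sin_sq_add_cos_sq (x / (2 * a)); linarith
    simp only [ptRaise, mul_add, Real.rpow_add hs, Real.rpow_add hc, mul_one,
      Real.rpow_two, Polynomial.eval_mul, Polynomial.eval_C, Polynomial.derivative_mul,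
      Polynomial.eval_add, Polynomial.eval_sub, Polynomial.eval_one, Polynomial.eval_X, hcs]
    ring
  · exact integrableOn_sin_rpow_mul_cos_rpow_mul_eval a (by positivity) (by positivity) _
  · exact (integrableOn_sin_rpow_mul_cos_rpow_mul_eval a (by positivity) (by positivity) _).const_mul _

lemma integral_ptPsi_mul_eq {a : ℝ} (ha : 0 < a) (l l' : ℝ) (n k : ℕ) :
    ∫ x in Ioo 0 (Real.pi * a), ptPsi a n l l' x * ptPsi a k l l' x =
      ∫ x in Ioo 0 (Real.pi * a), Real.sin (x / (2 * a)) ^ (2 * l) *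
        Real.cos (x / (2 * a)) ^ (2 * l') *
          (ptPoly a n l l' * ptPoly a k l l').eval (Real.sin (x / (2 * a)) ^ 2) := by
  refine setIntegral_congr_fun measurableSet_Ioo fun x hx => ?_
  simp only [ptPsi_eq_ptPoly ha _ l l' x hx, two_mul l, two_mul l', Real.rpow_add (pt_sin_pos ha hx),
    Real.rpow_add (pt_cos_pos ha hx), Polynomial.eval_mul]
  ring

lemma integral_ptPsi_zero_sq {a l l' : ℝ} (ha : 0 < a) (hl : 0 < l) (hl' : 0 < l') :
    ∫ x in Ioo 0 (Real.pi * a), ptPsi a 0 l l' x * ptPsi a 0 l l' x = 1 := by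
  set I := ∫ y in Ioo 0 (Real.pi * a),
    (Real.sin (y / (2 * a)) ^ l * Real.cos (y / (2 * a)) ^ l') ^ 2 with hI
  have hpos : 0 < I := by
    rw [hI, setIntegral_pos_iff_support_of_nonneg_ae]
    · have : (Function.support fun y : ℝ =>
          (Real.sin (y / (2 * a)) ^ l * Real.cos (y / (2 * a)) ^ l') ^ 2) ∩ Ioo 0 (Real.pi * a) =
          Ioo 0 (Real.pi * a) := by
        refine inter_eq_right.2 fun x hx => ?_
        have hs := pt_sin_pos ha hx
        have hc := pt_cos_pos ha hx
        exact (by positivity : (0 : ℝ) <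
          (Real.sin (x / (2 * a)) ^ l * Real.cos (x / (2 * a)) ^ l') ^ 2).ne'
      rw [this, Real.volume_Ioo]
      simp only [sub_zero, ENNReal.ofReal_pos]
      positivity
    · exact Filter.Eventually.of_forall fun x => sq_nonneg _
    · have h := (continuous_sin_rpow_mul_cos_rpow_mul_eval a hl.le hl'.le 1).pow 2
      simp only [Polynomial.eval_one, mul_one] at h
      exact (h.continuousOn.integrableOn_compact
        (isCompact_Icc (a := 0) (b := Real.pi * a))).mono_set Ioo_subset_Icc_self
  have h : ∀ x, ptPsi a 0 l l' x * ptPsi a 0 l l' x =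
      I⁻¹ * (Real.sin (x / (2 * a)) ^ l * Real.cos (x / (2 * a)) ^ l') ^ 2 := by
    intro x
    have hh : I ^ (-(1 / 2) : ℝ) * I ^ (-(1 / 2) : ℝ) = I⁻¹ := by
      rw [← Real.rpow_add hpos, ← Real.rpow_neg_one]
      norm_num
    simp only [ptPsi]
    rw [← hI, ← hh]
    ring
  simp only [h]
  rw [integral_const_mul, ← hI, inv_mul_cancel₀ hpos.ne']

/-- Moving one `A†` across the inner product lowers both indices and shifts `(l, l')` to `(l+1,
l'+1)`; hence the induction runs over all parameters simultaneously. -/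
lemma integral_ptPsi_mul_ptPsi {a : ℝ} (ha : 0 < a) (n : ℕ) : ∀ (k : ℕ) (l l' : ℝ), 0 < l → 0 < l' →
    ∫ x in Ioo 0 (Real.pi * a), ptPsi a n l l' x * ptPsi a k l l' x = if n = k then 1 else 0 := by
  -- The ground state has a constant polynomial factor, which the derivative arising from the
  -- integration by parts annihilates.
  have hzero : ∀ (k : ℕ) (l l' : ℝ), 0 < l → 0 < l' →
      ∫ x in Ioo 0 (Real.pi * a), ptPsi a 0 l l' x * ptPsi a (k + 1) l l' x = 0 := by
    intro k l l' hl hl'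
    rw [integral_ptPsi_mul_eq ha]
    simp only [ptPoly]
    rw [← mul_assoc, integral_mul_ptRaise ha hl hl', ← Polynomial.C_mul, Polynomial.derivative_C]
    simp
  induction n with
  | zero =>
    intro k l l' hl hl'
    cases k with
    | zero => simpa using integral_ptPsi_zero_sq ha hl hl'
    | succ k => simpa using hzero k l l' hl hl'
  | succ n ih =>
    intro k l l' hl hl'
    cases k with
    | zero =>
      simp only [mul_comm (ptPsi a (n + 1) l l' _)]
      simpa using hzero n l l' hl hl'
    | succ k =>
      have hE : ∀ j : ℕ, 0 < ptEnergy a l l' (j + 1) := fun j => by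
        rw [ptEnergy_eq]; positivity
      -- This is `A Ψ_{k+1}(a₁) = E_{k+1}^{1/2} Ψ_k(a₂)`, with `E^{1/2}` left as `E * E^{-1/2}`.
      have hk : Polynomial.derivative (ptPoly a (k + 1) l l') =
          Polynomial.C (a * (ptEnergy a l l' (k + 1) * ptEnergy a l l' (k + 1) ^ (-(1 / 2) : ℝ))) *
            ptPoly a k (l + 1) (l' + 1) := by
        rw [ptPoly, Polynomial.derivative_C_mul, derivative_ptRaise_ptPoly ha, ← mul_assoc,
          ← Polynomial.C_mul]
        congr 2
        field_simp
      have h1 : ∀ x, Real.sin (x / (2 * a)) ^ (2 * (l + 1)) *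
          Real.cos (x / (2 * a)) ^ (2 * (l' + 1)) * (Polynomial.derivative (Polynomial.C
          (ptEnergy a l l' (n + 1) ^ (-(1 / 2) : ℝ) * -(1 / (2 * a))) * ptPoly a (k + 1) l l') *
          ptPoly a n (l + 1) (l' + 1)).eval (Real.sin (x / (2 * a)) ^ 2) =
          (ptEnergy a l l' (n + 1) ^ (-(1 / 2) : ℝ) * -(1 / (2 * a)) *
          (a * (ptEnergy a l l' (k + 1) * ptEnergy a l l' (k + 1) ^ (-(1 / 2) : ℝ)))) *
          (Real.sin (x / (2 * a)) ^ (2 * (l + 1)) *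
          Real.cos (x / (2 * a)) ^ (2 * (l' + 1)) * (ptPoly a n (l + 1) (l' + 1) *
          ptPoly a k (l + 1) (l' + 1)).eval (Real.sin (x / (2 * a)) ^ 2)) := by
        intro x
        rw [Polynomial.derivative_C_mul, hk]
        simp only [Polynomial.eval_mul, Polynomial.eval_C]
        ring
      have h2 : ptPoly a (n + 1) l l' * ptPoly a (k + 1) l l' = (Polynomial.C
          (ptEnergy a l l' (n + 1) ^ (-(1 / 2) : ℝ) * -(1 / (2 * a))) * ptPoly a (k + 1) l l') *
          ptRaise l l' (ptPoly a n (l + 1) (l' + 1)) := by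
        rw [ptPoly]
        ring
      rw [integral_ptPsi_mul_eq ha, h2, integral_mul_ptRaise ha hl hl']
      simp only [h1]
      rw [integral_const_mul, ← integral_ptPsi_mul_eq ha, ih k _ _ (by positivity) (by positivity)]
      simp only [add_left_inj]
      split_ifs with h
      · subst h
        have hh : ptEnergy a l l' (n + 1) ^ (-(1 / 2) : ℝ) * ptEnergy a l l' (n + 1) ^ (-(1 / 2) : ℝ) *
            ptEnergy a l l' (n + 1) = 1 := by
          rw [← Real.rpow_add (hE n), show (-(1 / 2) + -(1 / 2) : ℝ) = -1 by norm_num,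
            Real.rpow_neg_one, inv_mul_cancel₀ (hE n).ne']
        field_simp at hh ⊢
        linarith
      · simp

lemma orthonormal_ptState {a l l' : ℝ} (ha : 0 < a) (hl : 3 / 2 ≤ l) (hl' : 3 / 2 ≤ l') :
    Orthonormal ℂ (fun n : ℕ => ptState ha hl hl' n) := by
  rw [orthonormal_iff_ite]
  intro n k
  have h : ⟪ptState ha hl hl' n, ptState ha hl hl' k⟫_ℂ =
      ∫ x in Ioo 0 (Real.pi * a), ((ptPsi a n l l' x * ptPsi a k l l' x : ℝ) : ℂ) := by
    rw [L2.inner_def]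
    refine integral_congr_ae ?_
    filter_upwards [(ptPsi_memLp a ha hl hl' n).coeFn_toLp,
      (ptPsi_memLp a ha hl hl' k).coeFn_toLp] with x h1 h2
    simp only [ptState]
    rw [h1, h2]
    simp [mul_comm]
  rw [h, integral_complex_ofReal, integral_ptPsi_mul_ptPsi ha n k l l' (by linarith) (by linarith)]
  split_ifs <;> simp

/-! ### Closed form and growth of `|K_n^m|²` -/

/-- The sum is `E_N - E_{k-1}`, a difference of quadratics that factors. The case `k = N + 1` is the
empty sum, where the first factor vanishes. -/
lemma sum_Icc_ptR (a l l' : ℝ) {k N : ℕ} (hk : 1 ≤ k) (hkN : k ≤ N + 1) :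
    ∑ s ∈ Finset.Icc k N, ptR a l l' s =
      1 / a ^ 2 * (((N : ℝ) - k + 1) * (l + l' + N + k - 1)) := by
  induction N with
  | zero =>
    obtain rfl : k = 1 := by omega
    simp
  | succ N ih =>
    rcases Nat.lt_or_ge (N + 1) k with h | h
    · obtain rfl : k = N + 1 + 1 := by omega
      simp
    · rw [Finset.sum_Icc_succ_top h, ih h, ptR]
      push_cast
      ring

lemma prod_range_add_mul_Gamma {y : ℝ} (hy : 0 < y) (n : ℕ) :
    (∏ i ∈ Finset.range n, (y + i)) * Real.Gamma y = Real.Gamma (y + n) := by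
  induction n with
  | zero => simp
  | succ n ih =>
    rw [Finset.prod_range_succ, mul_right_comm, ih, mul_comm, ← Real.Gamma_add_one (by positivity)]
    push_cast
    ring_nf

lemma prod_range_sub_mul_Gamma {y : ℝ} (j : ℕ) (hy : 0 < y - j + 1) :
    (∏ i ∈ Finset.range j, (y - i)) * Real.Gamma (y - j + 1) = Real.Gamma (y + 1) := by
  induction j with
  | zero => simp
  | succ j ih =>
    push_cast at hy
    rw [Finset.prod_range_succ, ← ih (by linarith), mul_assoc, Real.Gamma_add_one (s := y - j)
      (by linarith)]
    push_cast
    ring_nf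

lemma norm_ptZ (a l l' α : ℝ) (k : ℕ) : ‖ptZ a l l' α k‖ = 1 := by
  have : -Complex.I * α * ptR a l l' (1 + k) = ((-(α * ptR a l l' (1 + k)) : ℝ) : ℂ) * Complex.I := by
    push_cast
    ring
  rw [ptZ, this, Complex.norm_exp_ofReal_mul_I]

section

variable {a l l' : ℝ}

lemma sum_Icc_ptR_pos (ha : 0 < a) (hl : 3 / 2 ≤ l) (hl' : 3 / 2 ≤ l') {k N : ℕ} (hk : 1 ≤ k)
    (hkN : k ≤ N) : 0 < ∑ s ∈ Finset.Icc k N, ptR a l l' s := by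
  rw [sum_Icc_ptR a l l' hk (by omega)]
  have h1 : (k : ℝ) ≤ N := by exact_mod_cast hkN
  have h2 : (0 : ℝ) ≤ k := by positivity
  have h3 : 0 < ((N : ℝ) - k + 1) := by linarith
  have h4 : 0 < l + l' + N + k - 1 := by linarith
  positivity

lemma norm_sq_ptK (ha : 0 < a) (hl : 3 / 2 ≤ l) (hl' : 3 / 2 ≤ l') (α : ℝ) (m n : ℕ) :
    ‖ptK a l l' α m n‖ ^ 2 =
      (∏ k ∈ Finset.Icc (m + 1) (n + m), ∑ s ∈ Finset.Icc k (n + m), ptR a l l' s) /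
        ∏ k ∈ Finset.Icc 1 m, ∑ s ∈ Finset.Icc k (n + m), ptR a l l' s := by
  have h1 : 0 ≤ ∏ k ∈ Finset.Icc (m + 1) (n + m), ∑ s ∈ Finset.Icc k (n + m), ptR a l l' s := by
    refine Finset.prod_nonneg fun k hk => (sum_Icc_ptR_pos ha hl hl' ?_ ?_).le <;>
      · rw [Finset.mem_Icc] at hk; omega
  have h2 : 0 ≤ ∏ k ∈ Finset.Icc 1 m, ∑ s ∈ Finset.Icc k (n + m), ptR a l l' s := by
    refine Finset.prod_nonneg fun k hk => (sum_Icc_ptR_pos ha hl hl' ?_ ?_).le <;>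
      · rw [Finset.mem_Icc] at hk; omega
  rw [ptK, norm_div, norm_mul, norm_prod]
  simp only [norm_ptZ, Finset.prod_const_one, one_mul, Complex.norm_real, Real.norm_eq_abs,
    abs_of_nonneg (Real.sqrt_nonneg _)]
  rw [div_pow, Real.sq_sqrt h1, Real.sq_sqrt h2]

/-- The two linear factors of each sum run down and up in unit steps as `k` increases, so both
products telescope into Gamma quotients. The numerator produces `Γ(2(n+m+ρ))`, which the duplication
formula splits; this is the source of `2^{2n+2m+2ρ}/(2√π)`. -/
lemma norm_sq_ptK_eq (ha : 0 < a) (hl : 3 / 2 ≤ l) (hl' : 3 / 2 ≤ l') (α : ℝ) {ρ : ℝ}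
    (hρ : 2 * ρ = l + l') (m n : ℕ) :
    ‖ptK a l l' α m n‖ ^ 2 =
        (1 / a) ^ (2 * ((n : ℤ) - m)) * ((2 : ℝ) ^ (2 * n + 2 * m + 2 * ρ) /
            (2 * Real.sqrt Real.pi)) *
          (Real.Gamma (n + 1) ^ 2 * Real.Gamma (n + m + 2 * ρ) * Real.Gamma (n + m + ρ) *
              Real.Gamma (n + m + ρ + 1 / 2) /
            (Real.Gamma (n + m + 1) * Real.Gamma (n + 2 * m + 2 * ρ) ^ 2)) := by
  have hρ' : 3 / 2 ≤ ρ := by linarith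
  have hA : (∏ k ∈ Finset.Icc (m + 1) (n + m), ∑ s ∈ Finset.Icc k (n + m), ptR a l l' s) =
      (1 / a ^ 2) ^ n * (Real.Gamma (n + 1) *
        (Real.Gamma (2 * (n + m + ρ)) / Real.Gamma (n + 2 * m + 2 * ρ))) := by
    have h1 := prod_range_sub_mul_Gamma (y := n) n (by simp)
    have h2 := prod_range_add_mul_Gamma (y := n + 2 * m + 2 * ρ) (by positivity) n
    rw [sub_self, zero_add, Real.Gamma_one, mul_one] at h1
    rw [show (n + 2 * m + 2 * ρ + n : ℝ) = 2 * (n + m + ρ) by ring] at h2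
    rw [← h1, ← h2, mul_div_cancel_right₀ _ (Real.Gamma_pos_of_pos (by positivity)).ne',
      ← Finset.prod_mul_distrib, ← Finset.card_range n, ← Finset.prod_const, Finset.card_range,
      ← Finset.prod_mul_distrib, ← Finset.Ico_add_one_right_eq_Icc, Finset.prod_Ico_eq_prod_range,
      show n + m + 1 - (m + 1) = n by omega]
    refine Finset.prod_congr rfl fun i hi => ?_
    rw [Finset.mem_range] at hi
    rw [sum_Icc_ptR a l l' (by omega) (by omega)]
    push_cast
    rw [← hρ]
    ring
  have hB : (∏ k ∈ Finset.Icc 1 m, ∑ s ∈ Finset.Icc k (n + m), ptR a l l' s) =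
      (1 / a ^ 2) ^ m * (Real.Gamma (n + m + 1) / Real.Gamma (n + 1) *
        (Real.Gamma (n + 2 * m + 2 * ρ) / Real.Gamma (n + m + 2 * ρ))) := by
    have h1 := prod_range_sub_mul_Gamma (y := n + m) m (by rw [add_sub_cancel_right]; positivity)
    have h2 := prod_range_add_mul_Gamma (y := n + m + 2 * ρ) (by positivity) m
    rw [add_sub_cancel_right] at h1
    rw [show (n + m + 2 * ρ + m : ℝ) = n + 2 * m + 2 * ρ by ring] at h2
    rw [← h1, ← h2, mul_div_cancel_right₀ _ (Real.Gamma_pos_of_pos (by positivity)).ne',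
      mul_div_cancel_right₀ _ (Real.Gamma_pos_of_pos (by positivity)).ne',
      ← Finset.prod_mul_distrib, ← Finset.card_range m, ← Finset.prod_const, Finset.card_range,
      ← Finset.prod_mul_distrib, ← Finset.Ico_add_one_right_eq_Icc, Finset.prod_Ico_eq_prod_range,
      Nat.add_sub_cancel]
    refine Finset.prod_congr rfl fun i hi => ?_
    rw [Finset.mem_range] at hi
    rw [sum_Icc_ptR a l l' (by omega) (by omega)]
    push_cast
    rw [← hρ]
    ring
  have hd := Real.Gamma_mul_Gamma_add_half (n + m + ρ)
  have hΓ : Real.Gamma (2 * (n + m + ρ)) = (2 : ℝ) ^ (2 * n + 2 * m + 2 * ρ) /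
      (2 * Real.sqrt Real.pi) * (Real.Gamma (n + m + ρ) * Real.Gamma (n + m + ρ + 1 / 2)) := by
    rw [hd, show (1 - 2 * (n + m + ρ) : ℝ) = 1 - (2 * n + 2 * m + 2 * ρ) by ring,
      Real.rpow_sub two_pos, Real.rpow_one]
    have : (0 : ℝ) < 2 ^ (2 * n + 2 * m + 2 * ρ) := by positivity
    have : 0 < Real.sqrt Real.pi := Real.sqrt_pos.2 Real.pi_pos
    field_simp
  have hz : (1 / a) ^ (2 * ((n : ℤ) - m)) = (1 / a ^ 2) ^ n / (1 / a ^ 2) ^ m := by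
    rw [zpow_mul, zpow_sub₀ (by positivity), zpow_natCast, zpow_natCast]
    norm_cast
    rw [div_pow, one_pow]
  rw [norm_sq_ptK ha hl hl', hA, hB, hΓ, hz]
  have g1 := Real.Gamma_pos_of_pos (s := n + 1) (by positivity)
  have g2 := Real.Gamma_pos_of_pos (s := n + m + 1) (by positivity)
  have g3 := Real.Gamma_pos_of_pos (s := n + 2 * m + 2 * ρ) (by positivity)
  have g4 := Real.Gamma_pos_of_pos (s := n + m + 2 * ρ) (by positivity)
  field_simp

lemma norm_sq_ptK_pos (ha : 0 < a) (hl : 3 / 2 ≤ l) (hl' : 3 / 2 ≤ l') (α : ℝ) (m n : ℕ) :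
    0 < ‖ptK a l l' α m n‖ ^ 2 := by
  rw [norm_sq_ptK ha hl hl']
  refine div_pos (Finset.prod_pos fun k hk => sum_Icc_ptR_pos ha hl hl' ?_ ?_)
    (Finset.prod_pos fun k hk => sum_Icc_ptR_pos ha hl hl' ?_ ?_) <;>
      · rw [Finset.mem_Icc] at hk; omega

/-- In the ratio of consecutive terms everything beyond `((n+1)/a)²` is at least one, because `n+m+1
≤ n+m+2ρ` and `n+2m+2ρ ≤ 2(n+m+ρ)`. This drives the ratio test for all `x`. -/
lemma norm_sq_ptK_succ_ge (ha : 0 < a) (hl : 3 / 2 ≤ l) (hl' : 3 / 2 ≤ l') (α : ℝ) (m n : ℕ) :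
    ((n + 1) / a) ^ 2 * ‖ptK a l l' α m n‖ ^ 2 ≤ ‖ptK a l l' α m (n + 1)‖ ^ 2 := by
  obtain ⟨ρ, hρ⟩ : ∃ ρ, 2 * ρ = l + l' := ⟨(l + l') / 2, by ring⟩
  have hρ' : 3 / 2 ≤ ρ := by linarith
  rw [norm_sq_ptK_eq ha hl hl' α hρ, norm_sq_ptK_eq ha hl hl' α hρ]
  push_cast
  have e1 : (2 * ((n : ℤ) + 1 - m)) = 2 * ((n : ℤ) - m) + 2 := by ring
  have e2 : (2 * (n + 1) + 2 * m + 2 * ρ : ℝ) = 2 * n + 2 * m + 2 * ρ + 2 := by ring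
  have e3 : Real.Gamma (n + 1 + 1) = (n + 1) * Real.Gamma (n + 1) :=
    Real.Gamma_add_one (by positivity)
  have e4 : Real.Gamma (n + 1 + m + 2 * ρ) = (n + m + 2 * ρ) * Real.Gamma (n + m + 2 * ρ) := by
    rw [← Real.Gamma_add_one (by positivity)]; ring_nf
  have e5 : Real.Gamma (n + 1 + m + ρ) = (n + m + ρ) * Real.Gamma (n + m + ρ) := by
    rw [← Real.Gamma_add_one (by positivity)]; ring_nf
  have e6 : Real.Gamma (n + 1 + m + ρ + 1 / 2) =
      (n + m + ρ + 1 / 2) * Real.Gamma (n + m + ρ + 1 / 2) := by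
    rw [← Real.Gamma_add_one (by positivity)]; ring_nf
  have e7 : Real.Gamma (n + 1 + m + 1) = (n + m + 1) * Real.Gamma (n + m + 1) := by
    rw [← Real.Gamma_add_one (by positivity)]; ring_nf
  have e8 : Real.Gamma (n + 1 + 2 * m + 2 * ρ) =
      (n + 2 * m + 2 * ρ) * Real.Gamma (n + 2 * m + 2 * ρ) := by
    rw [← Real.Gamma_add_one (by positivity)]; ring_nf
  rw [e1, e2, e3, e4, e5, e6, e7, e8, zpow_add₀ (by positivity),
    Real.rpow_add two_pos _ 2]
  set z := (1 / a) ^ (2 * ((n : ℤ) - m)) with hz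
  set t := (2 : ℝ) ^ (2 * n + 2 * m + 2 * ρ) with ht
  have hz0 : 0 < z := by positivity
  have ht0 : 0 < t := by positivity
  have g1 := Real.Gamma_pos_of_pos (s := n + 1) (by positivity)
  have g2 := Real.Gamma_pos_of_pos (s := n + m + 1) (by positivity)
  have g3 := Real.Gamma_pos_of_pos (s := n + 2 * m + 2 * ρ) (by positivity)
  have g4 := Real.Gamma_pos_of_pos (s := n + m + 2 * ρ) (by positivity)
  have g5 := Real.Gamma_pos_of_pos (s := n + m + ρ) (by positivity)
  have g6 := Real.Gamma_pos_of_pos (s := n + m + ρ + 1 / 2) (by positivity)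
  generalize Real.Gamma (n + 1) = G1 at *
  generalize Real.Gamma (n + m + 1) = G2 at *
  generalize Real.Gamma (n + 2 * m + 2 * ρ) = G3 at *
  generalize Real.Gamma (n + m + 2 * ρ) = G4 at *
  generalize Real.Gamma (n + m + ρ) = G5 at *
  generalize Real.Gamma (n + m + ρ + 1 / 2) = G6 at *
  have hpi : 0 < Real.sqrt Real.pi := Real.sqrt_pos.2 Real.pi_pos
  generalize Real.sqrt Real.pi = q at *
  have hn : (0 : ℝ) ≤ n := by positivity
  have hm : (0 : ℝ) ≤ m := by positivity
  have key : (n + m + 1) * (n + 2 * m + 2 * ρ) ^ 2 ≤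
      4 * ((n + m + 2 * ρ) * (n + m + ρ) * (n + m + ρ + 1 / 2)) := by
    have h1 : (n + 2 * m + 2 * ρ) ^ 2 ≤ 4 * ((n + m + ρ) * (n + m + ρ + 1 / 2)) := by
      nlinarith
    have h2 : (n + m + 1 : ℝ) ≤ n + m + 2 * ρ := by linarith
    calc (n + m + 1) * (n + 2 * m + 2 * ρ) ^ 2 ≤
        (n + m + 2 * ρ) * (4 * ((n + m + ρ) * (n + m + ρ + 1 / 2))) := by gcongr
      _ = _ := by ring
  have hL : ((n + 1) / a) ^ 2 * (z * (t / (2 * q)) * (G1 ^ 2 * G4 * G5 * G6 / (G2 * G3 ^ 2))) =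
      (z * (t / (2 * q)) * (G1 ^ 2 * G4 * G5 * G6 / (G2 * G3 ^ 2)) * ((n + 1) / a) ^ 2) * 1 := by
    ring
  have hR : z * (1 / a) ^ (2 : ℤ) * (t * 2 ^ (2 : ℝ) / (2 * q)) *
      (((n + 1) * G1) ^ 2 * ((n + m + 2 * ρ) * G4) * ((n + m + ρ) * G5) *
        ((n + m + ρ + 1 / 2) * G6) / ((n + m + 1) * G2 * ((n + 2 * m + 2 * ρ) * G3) ^ 2)) =
      (z * (t / (2 * q)) * (G1 ^ 2 * G4 * G5 * G6 / (G2 * G3 ^ 2)) * ((n + 1) / a) ^ 2) *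
        (4 * ((n + m + 2 * ρ) * (n + m + ρ) * (n + m + ρ + 1 / 2)) /
          ((n + m + 1) * (n + 2 * m + 2 * ρ) ^ 2)) := by
    rw [Real.rpow_two, show ((1 / a) ^ (2 : ℤ) : ℝ) = (1 / a) ^ 2 by norm_cast]
    field_simp
    ring
  rw [hL, hR]
  refine mul_le_mul_of_nonneg_left ?_ (by positivity)
  rw [le_div_iff₀ (by positivity), one_mul]
  exact key

lemma summable_pow_div_norm_sq_ptK (ha : 0 < a) (hl : 3 / 2 ≤ l) (hl' : 3 / 2 ≤ l') (α : ℝ) (m : ℕ)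
    {x : ℝ} (hx : 0 ≤ x) : Summable fun n : ℕ => x ^ n / ‖ptK a l l' α m n‖ ^ 2 := by
  refine summable_of_ratio_norm_eventually_le (r := 1 / 2) (by norm_num) ?_
  -- From this index on `x ≤ ((n+1)/a)²/2`, so the ratio of consecutive terms is at most `1/2`.
  obtain ⟨N, hN⟩ := exists_nat_ge (2 * x * a ^ 2)
  filter_upwards [Filter.eventually_ge_atTop N] with n hn
  have h0 := norm_sq_ptK_pos ha hl hl' α m n
  have h1 := norm_sq_ptK_pos ha hl hl' α m (n + 1)
  have h2 := norm_sq_ptK_succ_ge ha hl hl' α m n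
  rw [Real.norm_of_nonneg (by positivity), Real.norm_of_nonneg (by positivity)]
  have hn' : (N : ℝ) ≤ n := by exact_mod_cast hn
  have hx2 : x ≤ 1 / 2 * ((n + 1) / a) ^ 2 := by
    rw [div_pow, mul_div_assoc', le_div_iff₀ (by positivity)]
    nlinarith [(by positivity : (0 : ℝ) ≤ n)]
  rw [div_le_iff₀ h1]
  calc x ^ (n + 1) = x ^ n * x := pow_succ _ _
    _ ≤ x ^ n * (1 / 2 * ((n + 1) / a) ^ 2) := by gcongr
    _ = 1 / 2 * (x ^ n / ‖ptK a l l' α m n‖ ^ 2) *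
        (((n + 1) / a) ^ 2 * ‖ptK a l l' α m n‖ ^ 2) := by
      generalize ‖ptK a l l' α m n‖ ^ 2 = μ at *
      field_simp
    _ ≤ _ := by gcongr

end

/-! ### Square-summable series in an orthonormal sequence -/

section Orthonormal

variable {E : Type*} [NormedAddCommGroup E] [InnerProductSpace ℂ E] [CompleteSpace E]
  {v : ℕ → E}

lemma Orthonormal.summable_smul (hv : Orthonormal ℂ v) {c : ℕ → ℂ}
    (hc : Summable fun n => ‖c n‖ ^ 2) : Summable fun n => c n • v n := by
  simpa using (hv.orthogonalFamily.summable_iff_norm_sq_summable c).2 hc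

lemma Orthonormal.inner_tsum_smul (hv : Orthonormal ℂ v) {c : ℕ → ℂ}
    (hc : Summable fun n => ‖c n‖ ^ 2) (k : ℕ) : ⟪v k, ∑' n, c n • v n⟫_ℂ = c k := by
  have h := (hv.summable_smul hc).hasSum.mapL (innerSL ℂ (v k))
  refine h.unique ?_
  have h2 : (fun n => innerSL ℂ (v k) (c n • v n)) = fun n => if n = k then c k else 0 := by
    funext n
    rw [innerSL_apply_apply, inner_smul_right, orthonormal_iff_ite.1 hv k n]
    by_cases hnk : n = k
    · simp [hnk]
    · simp [hnk, Ne.symm hnk]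
  rw [h2]
  exact hasSum_ite_eq k (c k)

lemma Orthonormal.hasSum_inner_tsum_smul (hv : Orthonormal ℂ v) {c : ℕ → ℂ}
    (hc : Summable fun n => ‖c n‖ ^ 2) (x : E) :
    HasSum (fun n => ⟪x, v n⟫_ℂ * c n) ⟪x, ∑' n, c n • v n⟫_ℂ := by
  have h := (hv.summable_smul hc).hasSum.mapL (innerSL ℂ x)
  simpa [inner_smul_right, mul_comm] using h

lemma Orthonormal.hasSum_norm_tsum_smul (hv : Orthonormal ℂ v) {c : ℕ → ℂ}
    (hc : Summable fun n => ‖c n‖ ^ 2) :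
    HasSum (fun n => ‖c n‖ ^ 2) (‖∑' n, c n • v n‖ ^ 2) := by
  have h := hv.hasSum_inner_tsum_smul hc (∑' n, c n • v n)
  rw [inner_self_eq_norm_sq_to_K] at h
  have h2 : (fun n => ⟪∑' n, c n • v n, v n⟫_ℂ * c n) = fun n => ((‖c n‖ ^ 2 : ℝ) : ℂ) := by
    funext n
    rw [← inner_conj_symm, hv.inner_tsum_smul hc, ← Complex.normSq_eq_conj_mul_self,
      Complex.normSq_eq_norm_sq]
  rw [h2] at h
  refine Complex.hasSum_ofReal.1 ?_
  push_cast at h ⊢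
  exact h

end Orthonormal

/-! ### The coherent states as unit vectors -/

section

variable {a l l' : ℝ}

lemma norm_sq_pow_div_ptK (a l l' α : ℝ) (m n : ℕ) (z : ℂ) :
    ‖z ^ n / ptK a l l' α m n‖ ^ 2 = (‖z‖ ^ 2) ^ n / ‖ptK a l l' α m n‖ ^ 2 := by
  rw [norm_div, norm_pow, div_pow]
  ring

lemma orthonormal_ptState_add (ha : 0 < a) (hl : 3 / 2 ≤ l) (hl' : 3 / 2 ≤ l') (m : ℕ) :
    Orthonormal ℂ (fun n : ℕ => ptState ha hl hl' (n + m)) :=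
  (orthonormal_ptState ha hl hl').comp (fun n => n + m) (add_left_injective m)

lemma ptN_tsum_pos (ha : 0 < a) (hl : 3 / 2 ≤ l) (hl' : 3 / 2 ≤ l') (α : ℝ) (m : ℕ)
    {x : ℝ} (hx : 0 ≤ x) : 0 < ∑' n : ℕ, x ^ n / ‖ptK a l l' α m n‖ ^ 2 := by
  refine (summable_pow_div_norm_sq_ptK ha hl hl' α m hx).tsum_pos (fun n => by positivity) 0 ?_
  have := norm_sq_ptK_pos ha hl hl' α m 0
  positivity

lemma ptN_pos (ha : 0 < a) (hl : 3 / 2 ≤ l) (hl' : 3 / 2 ≤ l') (α : ℝ) (m : ℕ)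
    {x : ℝ} (hx : 0 ≤ x) : 0 < ptN a l l' α m x :=
  Real.rpow_pos_of_pos (ptN_tsum_pos ha hl hl' α m hx) _

lemma summable_norm_sq_pow_div_ptK (ha : 0 < a) (hl : 3 / 2 ≤ l) (hl' : 3 / 2 ≤ l') (α : ℝ) (m : ℕ)
    (z : ℂ) : Summable fun n : ℕ => ‖z ^ n / ptK a l l' α m n‖ ^ 2 := by
  simpa only [norm_sq_pow_div_ptK] using summable_pow_div_norm_sq_ptK ha hl hl' α m (sq_nonneg ‖z‖)

lemma summable_smul_ptState (ha : 0 < a) (hl : 3 / 2 ≤ l) (hl' : 3 / 2 ≤ l') (α : ℝ) (m : ℕ)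
    (z : ℂ) : Summable fun n : ℕ => (z ^ n / ptK a l l' α m n) • ptState ha hl hl' (n + m) :=
  (orthonormal_ptState_add ha hl hl' m).summable_smul (summable_norm_sq_pow_div_ptK ha hl hl' α m z)

lemma norm_ptCoherent (ha : 0 < a) (hl : 3 / 2 ≤ l) (hl' : 3 / 2 ≤ l') (α : ℝ) (m : ℕ)
    (z : ℂ) : ‖ptCoherent ha hl hl' α m z‖ = 1 := by
  have h := ((orthonormal_ptState_add ha hl hl' m).hasSum_norm_tsum_smul
    (summable_norm_sq_pow_div_ptK ha hl hl' α m z)).tsum_eq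
  simp only [norm_sq_pow_div_ptK] at h
  have hS := ptN_tsum_pos ha hl hl' α m (sq_nonneg ‖z‖)
  rw [← sq_eq_sq₀ (norm_nonneg _) zero_le_one, ptCoherent, norm_smul, mul_pow, ← h,
    Complex.norm_real, Real.norm_eq_abs, sq_abs, ptN, ← Real.rpow_natCast, ← Real.rpow_mul hS.le]
  norm_num
  rw [Real.rpow_neg_one, inv_mul_cancel₀ hS.ne']

lemma tsum_smul_ptState_mem (ha : 0 < a) (hl : 3 / 2 ≤ l) (hl' : 3 / 2 ≤ l') (m : ℕ)
    {c : ℕ → ℂ} (hc : Summable fun n => c n • ptState ha hl hl' (n + m)) :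
    ∑' n, c n • ptState ha hl hl' (n + m) ∈ ptSubspace ha hl hl' m := by
  refine (Submodule.isClosed_topologicalClosure _).mem_of_tendsto hc.hasSum
    (Filter.Eventually.of_forall fun s => ?_)
  exact Submodule.sum_mem _ fun n _ => Submodule.smul_mem _ _
    (Submodule.le_topologicalClosure _ (Submodule.subset_span ⟨n, rfl⟩))

lemma ptCoherent_mem (ha : 0 < a) (hl : 3 / 2 ≤ l) (hl' : 3 / 2 ≤ l') (α : ℝ) (m : ℕ)
    (z : ℂ) : ptCoherent ha hl hl' α m z ∈ ptSubspace ha hl hl' m :=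
  Submodule.smul_mem _ _ (tsum_smul_ptState_mem ha hl hl' m (summable_smul_ptState ha hl hl' α m z))

end

/-! ### Mellin transforms of positive functions and fractional integrals -/

/-- Positive continuous functions on `(0, ∞)` that are `O(x^{-s})` for all `s > σ`; their Mellin
transform converges on `Re s > σ`. -/
structure MellinTame (f : ℝ → ℝ) (σ : ℝ) : Prop where
  continuousOn : ContinuousOn f (Ioi 0)
  pos : ∀ x, 0 < x → 0 < f x
  bound : ∀ s, σ < s → ∃ C, ∀ x, 0 < x → f x ≤ C * x ^ (-s)

namespace MellinTame

variable {f : ℝ → ℝ} {σ : ℝ}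

lemma mono (hf : MellinTame f σ) {τ : ℝ} (h : σ ≤ τ) : MellinTame f τ :=
  ⟨hf.continuousOn, hf.pos, fun s hs => hf.bound s (h.trans_lt hs)⟩

lemma isBigO (hf : MellinTame f σ) {s : ℝ} (hs : σ < s) {F : Filter ℝ} (hF : F ≤ Filter.principal (Ioi 0)) :
    (fun x => (f x : ℂ)) =O[F] fun x => x ^ (-s) := by
  obtain ⟨C, hC⟩ := hf.bound s hs
  refine Asymptotics.IsBigO.of_bound C (Filter.mem_of_superset (Filter.le_principal_iff.1 hF) fun x hx => ?_)
  have hx' : 0 < x := hx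
  simp only [mem_ofPred_eq, Complex.norm_real, Real.norm_eq_abs, abs_of_pos (hf.pos x hx'),
    abs_of_pos (Real.rpow_pos_of_pos hx' (-s))]
  exact hC x hx'

lemma mellinConvergent (hf : MellinTame f σ) {s : ℂ} (hs : σ < s.re) :
    MellinConvergent (fun x => (f x : ℂ)) s := by
  -- The same family of bounds serves both ends: exponent `Re s + 1` at infinity, and `r` strictly
  -- between `σ` and `Re s` at zero.
  obtain ⟨r, hr1, hr2⟩ := exists_between hs
  refine mellinConvergent_of_isBigO_rpow (a := s.re + 1) (b := r) ?_
    (hf.isBigO (by linarith) ?_) (by linarith) (hf.isBigO hr1 ?_) hr2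
  · exact (Complex.continuous_ofReal.comp_continuousOn hf.continuousOn).locallyIntegrableOn
      measurableSet_Ioi
  · exact Filter.le_principal_iff.2 (Filter.Ioi_mem_atTop 0)
  · exact Filter.le_principal_iff.2 self_mem_nhdsWithin

end MellinTame

lemma integrableOn_rpow_mul_one_sub_rpow {p q : ℝ} (hp : 0 < p) (hq : 0 < q) :
    IntegrableOn (fun t : ℝ => t ^ (p - 1) * (1 - t) ^ (q - 1)) (Ioo 0 1) := by
  have h := (Complex.betaIntegral_convergent (u := p) (v := q) (by simpa) (by simpa)).norm
  rw [intervalIntegrable_iff_integrableOn_Ioo_of_le zero_le_one] at h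
  refine h.congr_fun (fun t ht => ?_) measurableSet_Ioo
  have h1 : 0 < 1 - t := by linarith [ht.2]
  simp only [norm_mul]
  rw [Complex.norm_cpow_eq_rpow_re_of_pos ht.1,
    show (1 - t : ℂ) = ((1 - t : ℝ) : ℂ) by push_cast; ring,
    Complex.norm_cpow_eq_rpow_re_of_pos h1]
  simp

/-- The Erdélyi--Kober fractional integral, which multiplies the Mellin transform by
`Γ(s+b)/Γ(s+b+β)`. -/
noncomputable def erdelyiKober (b β : ℝ) (f : ℝ → ℝ) (x : ℝ) : ℝ :=
  (Real.Gamma β)⁻¹ * ∫ t in Ioo (0 : ℝ) 1, t ^ (b - 1) * (1 - t) ^ (β - 1) * f (x / t)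

namespace MellinTame

variable {f : ℝ → ℝ} {σ : ℝ}

lemma continuousOn_kernel (hf : MellinTame f σ) (b β : ℝ) :
    ContinuousOn (fun p : ℝ × ℝ => p.2 ^ (b - 1) * (1 - p.2) ^ (β - 1) * f (p.1 / p.2))
      (Ioi 0 ×ˢ Ioo 0 1) := by
  refine ContinuousOn.mul (ContinuousOn.mul ?_ ?_) ?_
  · exact continuousOn_snd.rpow_const fun p hp => Or.inl hp.2.1.ne'
  · exact (continuousOn_const.sub continuousOn_snd).rpow_const fun p hp =>
      Or.inl (sub_pos.2 hp.2.2).ne'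
  · exact hf.continuousOn.comp (continuousOn_fst.div continuousOn_snd fun p hp => hp.2.1.ne')
      fun p hp => div_pos hp.1 hp.2.1

/-- The bound separates `x` from `t`, with a Beta integrand in `t` that is integrable once `s + b >
0` and `β > 0`. It yields integrability, dominated convergence and the power bounds of the
fractional integral. -/
lemma kernel_le (hf : MellinTame f σ) (b β : ℝ) {s : ℝ} (hs : σ < s) : ∃ C, ∀ x, 0 < x →
    ∀ t ∈ Ioo (0 : ℝ) 1, t ^ (b - 1) * (1 - t) ^ (β - 1) * f (x / t) ≤
      C * x ^ (-s) * (t ^ (s + b - 1) * (1 - t) ^ (β - 1)) := by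
  obtain ⟨C, hC⟩ := hf.bound s hs
  refine ⟨C, fun x hx t ht => ?_⟩
  have h1 : 0 ≤ (1 - t) ^ (β - 1) := Real.rpow_nonneg (by linarith [ht.2]) _
  have h0 : 0 ≤ t ^ (b - 1) := Real.rpow_nonneg ht.1.le _
  calc t ^ (b - 1) * (1 - t) ^ (β - 1) * f (x / t)
      ≤ t ^ (b - 1) * (1 - t) ^ (β - 1) * (C * (x / t) ^ (-s)) := by
        gcongr
        exact hC _ (div_pos hx ht.1)
    _ = _ := by
        rw [Real.div_rpow hx.le ht.1.le, Real.rpow_neg ht.1.le,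
          show s + b - 1 = s + (b - 1) by ring, Real.rpow_add ht.1]
        field_simp

lemma aestronglyMeasurable_kernel (hf : MellinTame f σ) (b β : ℝ) {x : ℝ} (hx : 0 < x) :
    AEStronglyMeasurable (fun t => t ^ (b - 1) * (1 - t) ^ (β - 1) * f (x / t))
      (volume.restrict (Ioo 0 1)) :=
  ((hf.continuousOn_kernel b β).comp (Continuous.prodMk_right x).continuousOn
    fun _ ht => ⟨hx, ht⟩).aestronglyMeasurable measurableSet_Ioo

lemma kernel_pos (hf : MellinTame f σ) (b β : ℝ) {x : ℝ} (hx : 0 < x) {t : ℝ}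
    (ht : t ∈ Ioo (0 : ℝ) 1) : 0 < t ^ (b - 1) * (1 - t) ^ (β - 1) * f (x / t) :=
  mul_pos (mul_pos (Real.rpow_pos_of_pos ht.1 _) (Real.rpow_pos_of_pos (by linarith [ht.2]) _))
    (hf.pos _ (div_pos hx ht.1))

lemma integrableOn_kernel (hf : MellinTame f σ) {b β : ℝ} (hb : -b ≤ σ) (hβ : 0 < β) {x : ℝ}
    (hx : 0 < x) :
    IntegrableOn (fun t => t ^ (b - 1) * (1 - t) ^ (β - 1) * f (x / t)) (Ioo 0 1) := by
  obtain ⟨C, hC⟩ := hf.kernel_le b β (lt_add_one σ)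
  refine Integrable.mono' ((integrableOn_rpow_mul_one_sub_rpow (p := σ + 1 + b) (q := β)
    (by linarith) hβ).const_mul (C * x ^ (-(σ + 1)))) (hf.aestronglyMeasurable_kernel b β hx) ?_
  filter_upwards [ae_restrict_mem measurableSet_Ioo] with t ht
  rw [Real.norm_of_nonneg (hf.kernel_pos b β hx ht).le]
  exact hC x hx t ht

lemma erdelyiKober (hf : MellinTame f σ) {b β : ℝ} (hb : -b ≤ σ) (hβ : 0 < β) :
    MellinTame (erdelyiKober b β f) σ where
  continuousOn := by
    refine continuousOn_const.mul fun x₀ hx₀ => ContinuousAt.continuousWithinAt ?_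
    have hx₀' : 0 < x₀ := hx₀
    obtain ⟨C, hC⟩ := hf.kernel_le b β (lt_add_one σ)
    have hC0 : ContinuousAt (fun x : ℝ => C * x ^ (-(σ + 1))) x₀ :=
      continuousAt_const.mul (Real.continuousAt_rpow_const _ _ (Or.inl hx₀'.ne'))
    have hev : ∀ᶠ x in nhds x₀, C * x ^ (-(σ + 1)) < C * x₀ ^ (-(σ + 1)) + 1 :=
      hC0.eventually_lt_const (lt_add_one _)
    refine continuousAt_of_dominated
      (bound := fun t => (C * x₀ ^ (-(σ + 1)) + 1) * (t ^ (σ + 1 + b - 1) * (1 - t) ^ (β - 1)))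
      ?_ ?_ ?_ ?_
    · filter_upwards [lt_mem_nhds hx₀'] with x hx using hf.aestronglyMeasurable_kernel b β hx
    · filter_upwards [lt_mem_nhds hx₀', hev] with x hx hx2
      filter_upwards [ae_restrict_mem measurableSet_Ioo] with t ht
      rw [Real.norm_of_nonneg (hf.kernel_pos b β hx ht).le]
      refine (hC x hx t ht).trans ?_
      have h1 : 0 ≤ (1 - t) ^ (β - 1) := Real.rpow_nonneg (by linarith [ht.2]) _
      have h0 : 0 ≤ t ^ (σ + 1 + b - 1) := Real.rpow_nonneg ht.1.le _
      gcongr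
    · exact (integrableOn_rpow_mul_one_sub_rpow (p := σ + 1 + b) (q := β)
        (by linarith) hβ).const_mul _
    · filter_upwards [ae_restrict_mem measurableSet_Ioo] with t ht
      refine continuousAt_const.mul (ContinuousAt.comp (f := fun x => x / t) ?_ ?_)
      · exact hf.continuousOn.continuousAt (Ioi_mem_nhds (div_pos hx₀' ht.1))
      · exact continuousAt_id.div_const _
  pos := fun x hx => by
    refine mul_pos (inv_pos.2 (Real.Gamma_pos_of_pos hβ)) ?_
    rw [setIntegral_pos_iff_support_of_nonneg_ae _ (hf.integrableOn_kernel hb hβ hx)]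
    · rw [inter_eq_right.2 fun t ht => Function.mem_support.2 (hf.kernel_pos b β hx ht).ne',
        Real.volume_Ioo]
      simp
    · filter_upwards [ae_restrict_mem measurableSet_Ioo] with t ht using (hf.kernel_pos b β hx ht).le
  bound := fun s hs => by
    obtain ⟨C, hC⟩ := hf.kernel_le b β hs
    refine ⟨(Real.Gamma β)⁻¹ * (C * ∫ t in Ioo (0 : ℝ) 1, t ^ (s + b - 1) * (1 - t) ^ (β - 1)),
      fun x hx => ?_⟩
    rw [_root_.erdelyiKober, mul_assoc]
    refine mul_le_mul_of_nonneg_left ?_ (inv_pos.2 (Real.Gamma_pos_of_pos hβ)).le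
    rw [mul_right_comm, ← integral_const_mul]
    exact setIntegral_mono_on (hf.integrableOn_kernel hb hβ hx)
      ((integrableOn_rpow_mul_one_sub_rpow (by linarith) hβ).const_mul _) measurableSet_Ioo
      fun t ht => hC x hx t ht

lemma mellin_comp_div (f : ℝ → ℝ) (s : ℂ) {t : ℝ} (ht : 0 < t) :
    mellin (fun x => (f (x / t) : ℂ)) s = (t : ℂ) ^ s * mellin (fun x => (f x : ℂ)) s := by
  have h := mellin_comp_mul_left (fun x => (f x : ℂ)) s (inv_pos.2 ht)
  simp only [inv_mul_eq_div] at h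
  rw [h, smul_eq_mul, Complex.ofReal_inv, Complex.inv_cpow, ← Complex.cpow_neg, neg_neg]
  rw [Complex.arg_ofReal_of_nonneg ht.le]
  exact Real.pi_pos.ne

/-- After Fubini, the dilation `x ↦ x / t` contributes `t^s`, and the remaining integral over `t` is
the Beta function `B(s+b, β)`. Fubini is justified by the same computation with `Re s` in place of
`s`. -/
lemma mellin_erdelyiKober (hf : MellinTame f σ) {b β : ℝ} (hb : -b ≤ σ) (hβ : 0 < β) {s : ℂ}
    (hs : σ < s.re) :
    mellin (fun x => (_root_.erdelyiKober b β f x : ℂ)) s =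
      Complex.Gamma (s + b) / Complex.Gamma (s + b + β) * mellin (fun x => (f x : ℂ)) s := by
  set F : ℝ → ℝ → ℂ := fun x t =>
    (x : ℂ) ^ (s - 1) * ((t ^ (b - 1) * (1 - t) ^ (β - 1) * f (x / t) : ℝ) : ℂ) with hF
  have hnorm : ∀ t ∈ Ioo (0 : ℝ) 1, ∀ x ∈ Ioi (0 : ℝ), ‖F x t‖ =
      t ^ (b - 1) * (1 - t) ^ (β - 1) * ‖(x : ℂ) ^ (s - 1) • ((f (x / t) : ℝ) : ℂ)‖ := by
    intro t ht x hx
    have h1 : 0 ≤ (1 - t) ^ (β - 1) := Real.rpow_nonneg (by linarith [ht.2]) _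
    have h0 : 0 ≤ t ^ (b - 1) := Real.rpow_nonneg ht.1.le _
    simp only [hF, norm_mul, norm_smul, Complex.norm_real, Real.norm_eq_abs, abs_of_nonneg h1,
      abs_of_nonneg h0]
    ring
  have hconv : ∀ t, 0 < t → ∀ r : ℂ, σ < r.re →
      MellinConvergent (fun x => ((f (x / t) : ℝ) : ℂ)) r := by
    intro t ht r hr
    have h := (MellinConvergent.comp_mul_left (f := fun x => (f x : ℂ)) (s := r)
      (inv_pos.2 ht)).2 (hf.mellinConvergent hr)
    simpa only [inv_mul_eq_div] using h
  have hnormint : ∀ t ∈ Ioo (0 : ℝ) 1, ∫ x in Ioi 0, ‖F x t‖ =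
      (∫ x in Ioi (0 : ℝ), ‖(x : ℂ) ^ (s - 1) • (f x : ℂ)‖) *
        (t ^ (s.re + b - 1) * (1 - t) ^ (β - 1)) := by
    intro t ht
    rw [setIntegral_congr_fun measurableSet_Ioi (hnorm t ht), integral_const_mul]
    have h := mellin_comp_div f s.re ht.1
    -- As `f` is positive, the integral of the norm is itself a Mellin transform, at the real point
    -- `Re s`, and the dilation rule applies to it.
    have hreal : ∀ y, 0 < y → ∫ x in Ioi (0 : ℝ), ‖(x : ℂ) ^ (s - 1) • ((f (x / y) : ℝ) : ℂ)‖ =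
        (mellin (fun x => (f (x / y) : ℂ)) s.re).re := by
      intro y hy
      refine Eq.trans ?_ (integral_re (𝕜 := ℂ) (f := fun x : ℝ =>
        (x : ℂ) ^ ((s.re : ℂ) - 1) • ((f (x / y) : ℝ) : ℂ)) ?_)
      · refine setIntegral_congr_fun measurableSet_Ioi fun x hx => ?_
        have hx' : 0 < x := hx
        have he : ((s.re : ℂ) - 1) = ((s.re - 1 : ℝ) : ℂ) := by push_cast; ring
        simp only [norm_mul, smul_eq_mul, Complex.norm_cpow_eq_rpow_re_of_pos hx', Complex.norm_real,
          Real.norm_of_nonneg (hf.pos _ (div_pos hx' hy)).le, he, ← Complex.ofReal_cpow hx'.le,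
          ← Complex.ofReal_mul, RCLike.re_eq_complex_re, Complex.ofReal_re, Complex.sub_re,
          Complex.one_re]
      · exact hconv y hy s.re (by simpa)
    have h1 := hreal 1 one_pos
    simp only [div_one] at h1
    rw [hreal t ht.1, h1, h, ← Complex.ofReal_cpow ht.1.le, Complex.re_ofReal_mul,
      show s.re + b - 1 = s.re + (b - 1) by ring, Real.rpow_add ht.1]
    ring
  have hmeas : AEStronglyMeasurable (fun p : ℝ × ℝ => F p.1 p.2)
      ((volume.restrict (Ioi 0)).prod (volume.restrict (Ioo 0 1))) := by
    rw [Measure.prod_restrict]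
    refine ContinuousOn.aestronglyMeasurable (ContinuousOn.mul ?_ ?_)
      (measurableSet_Ioi.prod measurableSet_Ioo)
    · refine fun p hp => ContinuousAt.continuousWithinAt ?_
      exact ContinuousAt.comp (f := fun p : ℝ × ℝ => p.1) (g := fun x : ℝ => (x : ℂ) ^ (s - 1))
        (Complex.continuousAt_ofReal_cpow_const _ _ (Or.inr (ne_of_gt hp.1))) continuousAt_fst
    · exact Complex.continuous_ofReal.comp_continuousOn (hf.continuousOn_kernel b β)
  have hint : Integrable (fun p : ℝ × ℝ => F p.1 p.2)
      ((volume.restrict (Ioi 0)).prod (volume.restrict (Ioo 0 1))) := by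
    rw [integrable_prod_iff' hmeas]
    constructor
    · filter_upwards [ae_restrict_mem measurableSet_Ioo] with t ht
      refine ((hconv t ht.1 s hs).const_mul ((t ^ (b - 1) * (1 - t) ^ (β - 1) : ℝ) : ℂ)).congr
        (Filter.Eventually.of_forall fun x => ?_)
      simp only [hF, smul_eq_mul]
      push_cast
      ring
    · refine ((integrableOn_rpow_mul_one_sub_rpow (p := s.re + b) (q := β) (by linarith)
        hβ).const_mul (∫ x in Ioi (0 : ℝ), ‖(x : ℂ) ^ (s - 1) • (f x : ℂ)‖)).congr ?_
      filter_upwards [ae_restrict_mem measurableSet_Ioo] with t ht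
      exact (hnormint t ht).symm
  have hin : ∀ t ∈ Ioo (0 : ℝ) 1, ∫ x in Ioi 0, F x t = (t : ℂ) ^ (s + b - 1) *
      (1 - (t : ℂ)) ^ ((β : ℂ) - 1) * mellin (fun x => (f x : ℂ)) s := by
    intro t ht
    have h1t : 0 ≤ 1 - t := by linarith [ht.2]
    have h1 : ∀ x, F x t = ((t ^ (b - 1) * (1 - t) ^ (β - 1) : ℝ) : ℂ) *
        ((x : ℂ) ^ (s - 1) • ((f (x / t) : ℝ) : ℂ)) := fun x => by
      simp only [hF, smul_eq_mul]
      push_cast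
      ring
    simp only [h1]
    rw [integral_const_mul, ← mellin, mellin_comp_div f s ht.1, Complex.ofReal_mul,
      Complex.ofReal_cpow ht.1.le, Complex.ofReal_cpow h1t,
      show s + b - 1 = (b - 1) + s by ring, Complex.cpow_add _ _ (by exact_mod_cast ht.1.ne')]
    push_cast
    ring
  have hbeta := Complex.betaIntegral_eq_Gamma_mul_div (s + b) β (by simp; linarith) (by simpa)
  rw [Complex.betaIntegral, intervalIntegral.integral_of_le zero_le_one,
    integral_Ioc_eq_integral_Ioo] at hbeta
  have hΓ : Complex.Gamma β ≠ 0 := Complex.Gamma_ne_zero_of_re_pos (by simpa)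
  calc mellin (fun x => (_root_.erdelyiKober b β f x : ℂ)) s
      = (Complex.Gamma β)⁻¹ * ∫ x in Ioi 0, ∫ t in Ioo 0 1, F x t := by
        rw [mellin, ← integral_const_mul]
        refine integral_congr_ae (Filter.Eventually.of_forall fun x => ?_)
        simp only [hF, _root_.erdelyiKober, integral_const_mul]
        rw [integral_complex_ofReal, smul_eq_mul, Complex.ofReal_mul, Complex.ofReal_inv,
          ← Complex.Gamma_ofReal]
        ring
    _ = (Complex.Gamma β)⁻¹ * ∫ t in Ioo 0 1, ∫ x in Ioi 0, F x t := by
        rw [integral_integral_swap hint]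
    _ = _ := by
        rw [setIntegral_congr_fun measurableSet_Ioo hin, integral_mul_const, hbeta]
        field_simp

/-- Multiplication of the Mellin transform by `Γ(s+b)/Γ(s+b+β)` preserves positivity. -/
lemma exists_mellin_eq_Gamma_div_mul (hf : MellinTame f σ) {b β : ℝ} (hb : -b ≤ σ) (hβ : 0 ≤ β) :
    ∃ g, MellinTame g σ ∧ ∀ s : ℂ, σ < s.re → mellin (fun x => (g x : ℂ)) s =
      Complex.Gamma (s + b) / Complex.Gamma (s + b + β) * mellin (fun x => (f x : ℂ)) s := by
  -- For `β = 0` the quotient is `1` and `f` itself works; `erdelyiKober` would be zero there, since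
  -- `(Real.Gamma 0)⁻¹ = 0`. This case occurs when `m = 0`.
  rcases hβ.eq_or_lt with rfl | hβ
  · refine ⟨f, hf, fun s hs => ?_⟩
    have : Complex.Gamma (s + b) ≠ 0 :=
      Complex.Gamma_ne_zero_of_re_pos (by simp only [Complex.add_re, Complex.ofReal_re]; linarith)
    rw [Complex.ofReal_zero, add_zero, div_self this, one_mul]
  · exact ⟨_, hf.erdelyiKober hb hβ, fun s hs => hf.mellin_erdelyiKober hb hβ hs⟩

end MellinTame

/-! ### Gamma bounds on vertical lines -/

namespace Complex

lemma norm_Gamma_le_Gamma_re {s : ℂ} (hs : 0 < s.re) : ‖Gamma s‖ ≤ Real.Gamma s.re := by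
  rw [Gamma_eq_integral hs, Real.Gamma_eq_integral hs, GammaIntegral]
  refine (norm_integral_le_integral_norm _).trans (le_of_eq ?_)
  refine setIntegral_congr_fun measurableSet_Ioi fun x hx => ?_
  simp only [norm_mul, norm_cpow_eq_rpow_re_of_pos hx, norm_real, Real.norm_eq_abs, Real.abs_exp,
    sub_re, one_re]

/-- The functional equation trades one unit of `Re s` for decay `1/|s|`; two such factors are
already integrable along a vertical line. -/
lemma norm_Gamma_le_div {s : ℂ} (hs : 0 < s.re) : ‖Gamma s‖ ≤ Real.Gamma (s.re + 1) / ‖s‖ := by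
  have h0 : s ≠ 0 := fun h => by simp [h] at hs
  have h := norm_Gamma_le_Gamma_re (s := s + 1) (by simp; linarith)
  rw [Gamma_add_one s h0, norm_mul] at h
  rw [le_div_iff₀ (norm_pos_iff.2 h0), mul_comm]
  simpa using h

/-- The quotient is `B(s, β)/Γ(β)`, and the norm of the Beta integrand depends on `s` only through
`Re s`. -/
lemma exists_norm_Gamma_div_Gamma_add_le (p : ℝ) (hp : 0 < p) {β : ℝ} (hβ : 0 ≤ β) :
    ∃ C, ∀ s : ℂ, s.re = p → ‖Gamma s / Gamma (s + β)‖ ≤ C := by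
  rcases hβ.eq_or_lt with rfl | hβ
  · refine ⟨1, fun s hs => ?_⟩
    rw [ofReal_zero, add_zero, div_self (Gamma_ne_zero_of_re_pos (hs ▸ hp)), norm_one]
  · refine ⟨(∫ x in (0 : ℝ)..1, ‖(x : ℂ) ^ ((p : ℂ) - 1) * (1 - (x : ℂ)) ^ ((β : ℂ) - 1)‖) /
      ‖Gamma β‖, fun s hs => ?_⟩
    have hΓ : Gamma (β : ℂ) ≠ 0 := Gamma_ne_zero_of_re_pos (by simpa)
    have h := betaIntegral_eq_Gamma_mul_div s β (hs ▸ hp) (by simpa)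
    have h2 : Gamma s / Gamma (s + β) = betaIntegral s β / Gamma β := by
      rw [h]
      field_simp
    rw [h2, norm_div]
    gcongr
    rw [betaIntegral]
    refine (intervalIntegral.norm_integral_le_integral_norm zero_le_one).trans (le_of_eq ?_)
    rw [intervalIntegral.integral_of_le zero_le_one, intervalIntegral.integral_of_le zero_le_one]
    refine setIntegral_congr_fun measurableSet_Ioc fun x hx => ?_
    simp only [norm_mul, norm_cpow_eq_rpow_re_of_pos hx.1, sub_re, one_re, ofReal_re, hs]

lemma continuous_Gamma_vertical {b c : ℝ} (h : 0 < b + c) :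
    Continuous fun y : ℝ => Gamma (b + (c + y * I)) := by
  refine continuous_iff_continuousAt.2 fun y => ?_
  refine ContinuousAt.comp (f := fun y : ℝ => (b + (c + y * I) : ℂ)) (g := Gamma) ?_ (by fun_prop)
  refine (differentiableAt_Gamma _ fun n hn => ?_).continuousAt
  have := congrArg re hn
  simp only [add_re, ofReal_re, mul_re, I_re, mul_zero, ofReal_im, I_im, neg_re, natCast_re] at this
  have hn0 : (0 : ℝ) ≤ n := by positivity
  linarith

end Complex

/-! ### The G-function as a positive function -/

/-- The function with Mellin transform `Γ(s+ρ-1) Γ(s+ρ-1/2)`. -/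
noncomputable def mellinDupl (ρ x : ℝ) : ℝ :=
  Real.sqrt Real.pi * (x ^ (ρ - 1) * Real.exp (-(2 * x ^ (1 / 2 : ℝ))))

lemma mellinTame_mellinDupl (ρ : ℝ) : MellinTame (mellinDupl ρ) (1 - ρ) where
  continuousOn := by
    refine continuousOn_const.mul (ContinuousOn.mul ?_ ?_)
    · exact continuousOn_id.rpow_const fun x hx => Or.inl (ne_of_gt hx)
    · exact Real.continuous_exp.comp_continuousOn
        (continuousOn_const.mul (continuousOn_id.rpow_const fun x hx => Or.inl (ne_of_gt hx))).neg
  pos := fun x hx => by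
    have := Real.sqrt_pos.2 Real.pi_pos
    unfold mellinDupl
    positivity
  bound := fun s hs => by
    -- With `y = √x` the missing power is `y^q`, and `t ≤ e^t` at `t = y/q` gives `y^q ≤ q^q e^y`.
    -- Half of the exponent in `e^{-2y}` suffices to absorb it.
    set q := 2 * (s + ρ - 1) with hq
    have hq0 : 0 < q := by rw [hq]; linarith
    refine ⟨Real.sqrt Real.pi * q ^ q, fun x hx => ?_⟩
    set y := x ^ (1 / 2 : ℝ) with hy
    have hy0 : 0 < y := Real.rpow_pos_of_pos hx _
    have h1 : y ^ q ≤ q ^ q * Real.exp y := by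
      have h2 : y / q ≤ Real.exp (y / q) := by linarith [Real.add_one_le_exp (y / q)]
      have h3 := Real.rpow_le_rpow (by positivity) h2 hq0.le
      rw [Real.div_rpow hy0.le hq0.le, ← Real.exp_mul, div_mul_cancel₀ _ hq0.ne',
        div_le_iff₀ (by positivity)] at h3
      linarith
    have h2 : x ^ (ρ - 1) = y ^ q * x ^ (-s) := by
      rw [hy, ← Real.rpow_mul hx.le, ← Real.rpow_add hx, hq]
      ring_nf
    have h3 : Real.exp y * Real.exp (-(2 * y)) ≤ 1 := by
      rw [← Real.exp_add, Real.exp_le_one_iff]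
      linarith
    have h4 : 0 < q ^ q := by positivity
    have h5 : 0 ≤ x ^ (-s) := by positivity
    rw [mellinDupl, h2, ← hy, mul_assoc (Real.sqrt _)]
    refine mul_le_mul_of_nonneg_left ?_ (Real.sqrt_nonneg _)
    calc y ^ q * x ^ (-s) * Real.exp (-(2 * y))
        ≤ (q ^ q * Real.exp y) * x ^ (-s) * Real.exp (-(2 * y)) := by gcongr
      _ = (q ^ q * x ^ (-s)) * (Real.exp y * Real.exp (-(2 * y))) := by ring
      _ ≤ (q ^ q * x ^ (-s)) * 1 := by gcongr
      _ = _ := mul_one _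

/-- The substitution `y = 2√x` turns the integral into a multiple of `Γ(2(s+ρ-1))`, to which the
duplication formula applies. -/
lemma mellin_mellinDupl (ρ : ℝ) {s : ℂ} (hs : 1 - ρ < s.re) :
    mellin (fun x => (mellinDupl ρ x : ℂ)) s =
      Complex.Gamma (s + ρ - 1) * Complex.Gamma (s + ρ - 1 / 2) := by
  have hexp : mellin (fun x : ℝ => (Real.exp (-x) : ℂ)) (2 * (s + (ρ - 1))) =
      Complex.Gamma (2 * (s + (ρ - 1))) := by
    rw [Complex.Gamma_eq_integral (by simp; linarith), Complex.GammaIntegral_eq_mellin]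
  have h1 := mellin_comp_mul_left (fun x : ℝ => (Real.exp (-x) : ℂ)) (2 * (s + (ρ - 1))) two_pos
  have h2 := mellin_comp_rpow (fun x : ℝ => (Real.exp (-(2 * x)) : ℂ)) (s + (ρ - 1)) (1 / 2)
  have h3 := mellin_cpow_smul (fun x : ℝ => (Real.exp (-(2 * x ^ (1 / 2 : ℝ))) : ℂ)) s (ρ - 1)
  have h4 : mellin (fun x => (mellinDupl ρ x : ℂ)) s = (Real.sqrt Real.pi : ℂ) *
      mellin (fun x : ℝ => (x : ℂ) ^ ((ρ : ℂ) - 1) • (Real.exp (-(2 * x ^ (1 / 2 : ℝ))) : ℂ)) s := by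
    rw [mellin, mellin, ← integral_const_mul]
    refine setIntegral_congr_fun measurableSet_Ioi fun x hx => ?_
    have hx' : 0 < x := hx
    simp only [mellinDupl, smul_eq_mul, Complex.ofReal_mul, Complex.ofReal_cpow hx'.le]
    push_cast
    ring
  have hd := Complex.Gamma_mul_Gamma_add_half (s + (ρ - 1))
  rw [show s + ρ - 1 / 2 = s + (ρ - 1) + 1 / 2 by ring, show s + ρ - 1 = s + (ρ - 1) by ring, hd, h4,
    h3, h2, show (s + (ρ - 1)) / ((1 / 2 : ℝ) : ℂ) = 2 * (s + (ρ - 1)) by push_cast; ring, h1, hexp]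
  rw [Complex.cpow_sub _ _ two_ne_zero, Complex.cpow_one, Complex.ofReal_ofNat, Complex.cpow_neg]
  rw [show |(1 / 2 : ℝ)|⁻¹ = 2 by rw [abs_of_pos] <;> norm_num]
  simp only [smul_eq_mul, Complex.real_smul]
  push_cast
  ring

/-- The pairing of numerator and denominator parameters is chosen so that the increments `2ρ-1+2m`,
`m`, `m` are nonnegative; the unpaired `ρ-1`, `ρ-1/2` differ by one half. -/
lemma meijerKernel_eq (ρ : ℝ) (m : ℕ) (s : ℂ) :
    meijerKernel [] (ptTop ρ m) (ptBottom ρ m) [] s =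
      Complex.Gamma (s + (-m : ℝ)) / Complex.Gamma (s + (-m : ℝ) + (2 * ρ - 1 + 2 * m : ℝ)) *
      (Complex.Gamma (s + (2 * ρ - 1 : ℝ)) / Complex.Gamma (s + (2 * ρ - 1 : ℝ) + (m : ℝ)) *
      (Complex.Gamma (s + (-m : ℝ)) / Complex.Gamma (s + (-m : ℝ) + (m : ℝ)) *
      (Complex.Gamma (s + ρ - 1) * Complex.Gamma (s + ρ - 1 / 2)))) := by
  simp only [meijerKernel, ptTop, ptBottom, List.map_cons, List.map_nil, List.prod_cons,
    List.prod_nil, mul_one, one_mul]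
  rw [show s + (-m : ℝ) + (2 * ρ - 1 + 2 * m : ℝ) = -1 + 2 * ρ + m + s by push_cast; ring,
    show s + (2 * ρ - 1 : ℝ) + (m : ℝ) = -1 + 2 * ρ + m + s by push_cast; ring,
    show s + (-m : ℝ) + (m : ℝ) = 0 + s by push_cast; ring,
    show s + (-m : ℝ) = -m + s by push_cast; ring,
    show s + (2 * ρ - 1 : ℝ) = 2 * ρ - 1 + s by push_cast; ring,
    show s + ρ - 1 = -1 + ρ + s by ring, show s + ρ - 1 / 2 = -(1 / 2) + ρ + s by ring]
  simp only [div_eq_mul_inv, mul_inv]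
  ring

lemma exists_mellin_eq_meijerKernel {ρ : ℝ} (hρ : 3 / 2 ≤ ρ) (m : ℕ) :
    ∃ H, MellinTame H m ∧ ∀ s : ℂ, m < s.re →
      mellin (fun x => (H x : ℂ)) s = meijerKernel [] (ptTop ρ m) (ptBottom ρ m) [] s := by
  have hm : (0 : ℝ) ≤ m := by positivity
  obtain ⟨f, hf, hf'⟩ := ((mellinTame_mellinDupl ρ).mono
    (show 1 - ρ ≤ m by linarith)).exists_mellin_eq_Gamma_div_mul (b := -m) (β := m) (by simp) hm
  obtain ⟨g, hg, hg'⟩ := hf.exists_mellin_eq_Gamma_div_mul (b := 2 * ρ - 1) (β := m)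
    (by linarith) hm
  obtain ⟨H, hH, hH'⟩ := hg.exists_mellin_eq_Gamma_div_mul (b := -m) (β := 2 * ρ - 1 + 2 * m)
    (by simp) (by linarith)
  refine ⟨H, hH, fun s hs => ?_⟩
  rw [hH' s hs, hg' s hs, hf' s hs, mellin_mellinDupl ρ (by linarith), meijerKernel_eq]

lemma verticalIntegrable_meijerKernel {ρ : ℝ} (hρ : 3 / 2 ≤ ρ) (m : ℕ) {c : ℝ} (hc : m < c) :
    Complex.VerticalIntegrable (meijerKernel [] (ptTop ρ m) (ptBottom ρ m) []) c := by
  have hm : (0 : ℝ) ≤ m := by positivity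
  have hcont : Continuous fun y : ℝ =>
      meijerKernel [] (ptTop ρ m) (ptBottom ρ m) [] (c + y * Complex.I) := by
    have hb : ∀ (b : ℝ) (β : ℂ), (b : ℂ) = β → 0 < b + c →
        Continuous fun y : ℝ => Complex.Gamma (β + (c + y * Complex.I)) := by
      rintro b _ rfl h
      exact Complex.continuous_Gamma_vertical h
    have hne : ∀ (b : ℝ) (β : ℂ), (b : ℂ) = β → 0 < b + c →
        ∀ y : ℝ, Complex.Gamma (β + (c + y * Complex.I)) ≠ 0 := by
      rintro b _ rfl h y
      exact Complex.Gamma_ne_zero_of_re_pos (by simpa)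
    simp only [meijerKernel, ptTop, ptBottom, List.map_cons, List.map_nil, List.prod_cons,
      List.prod_nil, mul_one, one_mul]
    have ht1 : ((0 : ℝ) : ℂ) = 0 := by simp
    have ht2 : ((-1 + 2 * ρ + m : ℝ) : ℂ) = -1 + 2 * ρ + m := by push_cast; ring
    have h1 := hb (-m) (-m) (by simp) (by linarith)
    have h2 := hb (2 * ρ - 1) (2 * ρ - 1) (by push_cast; ring) (by linarith)
    have h3 := hb (-1 + ρ) (-1 + ρ) (by push_cast; ring) (by linarith)
    have h4 := hb (-(1 / 2) + ρ) (-(1 / 2) + ρ) (by push_cast; ring) (by linarith)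
    have h5 := hb _ _ ht1 (by linarith)
    have h6 := hb _ _ ht2 (by linarith)
    refine (h1.mul (h1.mul (h2.mul (h3.mul h4)))).div (h5.mul (h6.mul h6)) fun y => ?_
    exact mul_ne_zero (hne _ _ ht1 (by linarith) y)
      (mul_ne_zero (hne _ _ ht2 (by linarith) y) (hne _ _ ht2 (by linarith) y))
  obtain ⟨C₁, h₁⟩ := Complex.exists_norm_Gamma_div_Gamma_add_le (c + -m) (by linarith)
    (β := 2 * ρ - 1 + 2 * m) (by linarith)
  obtain ⟨C₂, h₂⟩ := Complex.exists_norm_Gamma_div_Gamma_add_le (c + (2 * ρ - 1)) (by linarith)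
    (β := m) hm
  obtain ⟨C₃, h₃⟩ := Complex.exists_norm_Gamma_div_Gamma_add_le (c + -m) (by linarith)
    (β := m) hm
  set D := Real.Gamma (c + ρ - 1 + 1) * Real.Gamma (c + ρ - 1 / 2 + 1) with hD
  have hD0 : 0 ≤ D := mul_nonneg (Real.Gamma_nonneg_of_nonneg (by linarith))
    (Real.Gamma_nonneg_of_nonneg (by linarith))
  refine Integrable.mono' ((integrable_inv_one_add_sq).const_mul (C₁ * (C₂ * (C₃ * (D * 4)))))
    hcont.aestronglyMeasurable (Filter.Eventually.of_forall fun y => ?_)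
  set s : ℂ := c + y * Complex.I with hs
  have hre : s.re = c := by simp [hs]
  have him : s.im = y := by simp [hs]
  have b1 := h₁ (s + (-m : ℝ)) (by rw [Complex.add_re, hre, Complex.ofReal_re])
  have b2 := h₂ (s + (2 * ρ - 1 : ℝ)) (by rw [Complex.add_re, hre, Complex.ofReal_re])
  have b3 := h₃ (s + (-m : ℝ)) (by rw [Complex.add_re, hre, Complex.ofReal_re])
  have r1 : (s + ρ - 1).re = c + ρ - 1 := by simp [hre]
  have r2 : (s + ρ - 1 / 2).re = c + ρ - 1 / 2 := by simp [hre]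
  have i1 : (s + ρ - 1).im = y := by simp [him]
  have i2 : (s + ρ - 1 / 2).im = y := by simp [him]
  have g1 := Complex.norm_Gamma_le_div (s := s + ρ - 1) (by rw [r1]; linarith)
  have g2 := Complex.norm_Gamma_le_div (s := s + ρ - 1 / 2) (by rw [r2]; linarith)
  rw [r1] at g1
  rw [r2] at g2
  -- Both Gamma arguments have real part at least `1/2`, because `c > m ≥ 0` and `ρ ≥ 3/2`. The two
  -- bounds multiply to `4/(1+y²)`, while the three quotients stay bounded.
  have hlow : ∀ w : ℂ, 1 / 2 ≤ w.re → w.im = y → Real.sqrt ((1 + y ^ 2) / 4) ≤ ‖w‖ := by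
    intro w hw hy
    rw [Complex.norm_eq_sqrt_sq_add_sq, hy]
    exact Real.sqrt_le_sqrt (by nlinarith)
  have n1 := hlow (s + ρ - 1) (by rw [r1]; linarith) i1
  have n2 := hlow (s + ρ - 1 / 2) (by rw [r2]; linarith) i2
  have hq : 0 < Real.sqrt ((1 + y ^ 2) / 4) := Real.sqrt_pos.2 (by positivity)
  have b4 : ‖Complex.Gamma (s + ρ - 1) * Complex.Gamma (s + ρ - 1 / 2)‖ ≤
      D * 4 * (1 + y ^ 2)⁻¹ := by
    have k1 : 0 ≤ Real.Gamma (c + ρ - 1 + 1) := Real.Gamma_nonneg_of_nonneg (by linarith)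
    have k2 : 0 ≤ Real.Gamma (c + ρ - 1 / 2 + 1) := Real.Gamma_nonneg_of_nonneg (by linarith)
    have e1 := g1.trans (div_le_div_of_nonneg_left k1 hq n1)
    have e2 := g2.trans (div_le_div_of_nonneg_left k2 hq n2)
    rw [norm_mul]
    refine (mul_le_mul e1 e2 (norm_nonneg _) (by positivity)).trans (le_of_eq ?_)
    rw [div_mul_div_comm, ← hD, Real.mul_self_sqrt (by positivity)]
    field_simp
  have c1 := (norm_nonneg _).trans b1
  have c2 := (norm_nonneg _).trans b2
  have c3 := (norm_nonneg _).trans b3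
  rw [meijerKernel_eq]
  simp only [norm_mul _ (_ * _)]
  calc _ ≤ C₁ * (C₂ * (C₃ * (D * 4 * (1 + y ^ 2)⁻¹))) := by
        gcongr
    _ = _ := by ring

/-- Mellin inversion; continuity of `H` makes the equality hold at every point of `(0, ∞)`. -/
lemma meijerG_eq {ρ : ℝ} (hρ : 3 / 2 ≤ ρ) {m : ℕ} {H : ℝ → ℝ} (hH : MellinTame H m)
    (hH' : ∀ s : ℂ, m < s.re →
      mellin (fun x => (H x : ℂ)) s = meijerKernel [] (ptTop ρ m) (ptBottom ρ m) [] s)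
    {c : ℝ} (hc : m < c) {x : ℝ} (hx : 0 < x) :
    meijerG [] (ptTop ρ m) (ptBottom ρ m) [] c x = H x := by
  have hline : ∀ y : ℝ, mellin (fun x => (H x : ℂ)) (c + y * Complex.I) =
      meijerKernel [] (ptTop ρ m) (ptBottom ρ m) [] (c + y * Complex.I) :=
    fun y => hH' _ (by simpa)
  rw [← mellinInv_mellin_eq c (fun x => (H x : ℂ)) hx (hH.mellinConvergent (by simpa))]
  · rw [meijerG, mellinInv, mellinInv]
    simp only [hline]
  · have h := verticalIntegrable_meijerKernel hρ m hc
    unfold Complex.VerticalIntegrable at h ⊢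
    simpa only [hline] using h
  · exact Complex.continuous_ofReal.continuousAt.comp
      (hH.continuousOn.continuousAt (Ioi_mem_nhds hx))

/-! ### Parseval's identity for pointwise expansions, and the projection -/

section L2

variable {X : Type*} [MeasurableSpace X] {μ : Measure X} {φ : ℕ → X → ℂ}

/-- A series of square-integrable functions that converges pointwise and in `L²` has the same sum
in both senses. -/
lemma ae_eq_tsum_toLp (hφ : ∀ n, MemLp (φ n) 2 μ) {c : ℕ → ℂ}
    (hc : Summable fun n => c n • (hφ n).toLp (φ n)) {F : X → ℂ}
    (hF : ∀ᵐ x ∂μ, HasSum (fun n => c n * φ n x) (F x)) :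
    F =ᵐ[μ] (∑' n, c n • (hφ n).toLp (φ n) : Lp ℂ 2 μ) := by
  have hlim := tendstoInMeasure_of_tendsto_Lp hc.hasSum.tendsto_sum_nat
  -- A subsequence of the partial sums converges almost everywhere to the `L²` sum; the pointwise
  -- sum is its only possible limit.
  obtain ⟨ns, hns, hae⟩ := hlim.exists_seq_tendsto_ae
  have hpart : ∀ᵐ x ∂μ, ∀ N : ℕ, (∑ n ∈ Finset.range N, c n • (hφ n).toLp (φ n) : Lp ℂ 2 μ) x =
      ∑ n ∈ Finset.range N, c n * φ n x := by
    refine ae_all_iff.2 fun N => ?_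
    have h1 : ∀ᵐ x ∂μ, ∀ n : ℕ, (c n • (hφ n).toLp (φ n) : Lp ℂ 2 μ) x = c n * φ n x := by
      refine ae_all_iff.2 fun n => ?_
      filter_upwards [Lp.coeFn_smul (c n) ((hφ n).toLp (φ n)), (hφ n).coeFn_toLp] with x h2 h3
      rw [h2, Pi.smul_apply, h3, smul_eq_mul]
    filter_upwards [h1, Lp.coeFn_finsetSum (Finset.range N) fun n => c n • (hφ n).toLp (φ n)]
      with x h2 h3
    rw [h3, Finset.sum_apply]
    exact Finset.sum_congr rfl fun n _ => h2 n
  filter_upwards [hF, hae, hpart] with x h1 h2 h3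
  simp only [h3] at h2
  exact tendsto_nhds_unique (h1.tendsto_sum_nat.comp hns.tendsto_atTop) h2

/-- Parseval's identity for pointwise convergent expansions in an orthonormal sequence. -/
lemma integral_mul_conj_of_hasSum (hφ : ∀ n, MemLp (φ n) 2 μ)
    (hort : Orthonormal ℂ fun n => (hφ n).toLp (φ n)) {c d : ℕ → ℂ}
    (hc : Summable fun n => ‖c n‖ ^ 2) (hd : Summable fun n => ‖d n‖ ^ 2) {F G : X → ℂ}
    (hF : ∀ᵐ x ∂μ, HasSum (fun n => c n * φ n x) (F x))
    (hG : ∀ᵐ x ∂μ, HasSum (fun n => d n * φ n x) (G x)) :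
    Integrable (fun x => F x * (starRingEnd ℂ) (G x)) μ ∧
      HasSum (fun n => c n * (starRingEnd ℂ) (d n)) (∫ x, F x * (starRingEnd ℂ) (G x) ∂μ) := by
  have hF' := ae_eq_tsum_toLp hφ (hort.summable_smul hc) hF
  have hG' := ae_eq_tsum_toLp hφ (hort.summable_smul hd) hG
  set S : Lp ℂ 2 μ := ∑' n, c n • (hφ n).toLp (φ n) with hS
  set T : Lp ℂ 2 μ := ∑' n, d n • (hφ n).toLp (φ n) with hT
  have hae : (fun x => ⟪T x, S x⟫_ℂ) =ᵐ[μ] fun x => F x * (starRingEnd ℂ) (G x) := by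
    filter_upwards [hF', hG'] with x h1 h2
    rw [h1, h2]
    rfl
  refine ⟨(L2.integrable_inner (𝕜 := ℂ) T S).congr hae, ?_⟩
  have h := hort.hasSum_inner_tsum_smul hc T
  rw [← hS, L2.inner_def, integral_congr_ae hae] at h
  have hterm : (fun n => ⟪T, (hφ n).toLp (φ n)⟫_ℂ * c n) =
      fun n => c n * (starRingEnd ℂ) (d n) := by
    funext n
    rw [← inner_conj_symm, hT, hort.inner_tsum_smul hd, mul_comm]
  rwa [hterm] at h

end L2

section

variable {E : Type*} [NormedAddCommGroup E] [InnerProductSpace ℂ E] [CompleteSpace E]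
  {v : ℕ → E}

lemma Orthonormal.starProjection_topologicalClosure_span (hv : Orthonormal ℂ v)
    [(Submodule.span ℂ (range v)).topologicalClosure.HasOrthogonalProjection] (x : E) :
    (Submodule.span ℂ (range v)).topologicalClosure.starProjection x = ∑' n, ⟪v n, x⟫_ℂ • v n := by
  have hc : Summable fun n => ‖⟪v n, x⟫_ℂ‖ ^ 2 := Orthonormal.inner_products_summable x hv
  have hs := hv.summable_smul hc
  refine Submodule.eq_starProjection_of_mem_of_inner_eq_zero ?_ ?_
  · refine (Submodule.isClosed_topologicalClosure _).mem_of_tendsto hs.hasSum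
      (Filter.Eventually.of_forall fun s => ?_)
    exact Submodule.sum_mem _ fun n _ => Submodule.smul_mem _ _
      (Submodule.le_topologicalClosure _ (Submodule.subset_span ⟨n, rfl⟩))
  -- The residual is orthogonal to each `v k`, and its orthogonal complement is a closed subspace,
  -- hence contains the closed span.
  · have hle : (Submodule.span ℂ (range v)).topologicalClosure ≤
        (Submodule.span ℂ {x - ∑' n, ⟪v n, x⟫_ℂ • v n})ᗮ := by
      refine Submodule.topologicalClosure_minimal _ ?_ (Submodule.isClosed_orthogonal _)
      rw [Submodule.span_le]
      rintro _ ⟨k, rfl⟩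
      rw [SetLike.mem_coe, Submodule.mem_orthogonal_singleton_iff_inner_left, inner_sub_right,
        hv.inner_tsum_smul hc, sub_self]
    intro w hw
    exact Submodule.mem_orthogonal_singleton_iff_inner_right.1 (hle hw)

lemma Orthonormal.hasSum_inner_mul_inner_starProjection (hv : Orthonormal ℂ v)
    [(Submodule.span ℂ (range v)).topologicalClosure.HasOrthogonalProjection] (x y : E) :
    HasSum (fun n => ⟪x, v n⟫_ℂ * ⟪v n, y⟫_ℂ)
      ⟪x, (Submodule.span ℂ (range v)).topologicalClosure.starProjection y⟫_ℂ := by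
  rw [hv.starProjection_topologicalClosure_span]
  exact hv.hasSum_inner_tsum_smul (Orthonormal.inner_products_summable y hv) x

end

/-! ### Radial integrals over the plane -/

/-- Monomials of different degrees are orthogonal for every rotation-invariant weight. -/
lemma integral_radial_mul_conj_pow_mul_pow (w : ℝ → ℂ) {n k : ℕ} (hnk : n ≠ k) :
    ∫ z : ℂ, w ‖z‖ * ((starRingEnd ℂ) z ^ n * z ^ k) = 0 := by
  -- The angle is chosen so that the rotation multiplies the integrand by `e^{i(k-n)θ} = -1`. The
  -- integral then equals its own negative, with no integrability needed.
  set θ : ℝ := Real.pi / ((k : ℝ) - n) with hθ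
  have hne : (k : ℝ) - n ≠ 0 := sub_ne_zero.2 (by exact_mod_cast hnk.symm)
  set u : Circle := Circle.exp θ with hu
  have hphase : (starRingEnd ℂ) (u : ℂ) ^ n * (u : ℂ) ^ k = -1 := by
    rw [hu, Circle.coe_exp, ← Complex.exp_conj, ← Complex.exp_nat_mul, ← Complex.exp_nat_mul,
      ← Complex.exp_add, ← Complex.exp_pi_mul_I]
    congr 1
    simp only [map_mul, Complex.conj_ofReal, Complex.conj_I]
    have : (θ : ℂ) * (k - n) = Real.pi := by
      rw [hθ]
      have : ((k : ℂ) - n) ≠ 0 := by exact_mod_cast hne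
      push_cast
      field_simp
    rw [← this]
    ring
  have h := (rotation u).measurePreserving.integral_comp
    (rotation u).toHomeomorph.measurableEmbedding
    (fun z : ℂ => w ‖z‖ * ((starRingEnd ℂ) z ^ n * z ^ k))
  have h2 : ∀ z : ℂ, w ‖rotation u z‖ * ((starRingEnd ℂ) (rotation u z) ^ n * (rotation u z) ^ k) =
      -1 * (w ‖z‖ * ((starRingEnd ℂ) z ^ n * z ^ k)) := by
    intro z
    rw [LinearIsometryEquiv.norm_map, rotation_apply, map_mul, mul_pow, mul_pow, ← hphase]
    ring
  simp only [h2] at h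
  rw [integral_const_mul] at h
  exact self_eq_neg.1 (by rw [← neg_one_mul, h])

lemma integral_comp_norm_complex (F : ℝ → ℝ) :
    ∫ z : ℂ, F (‖z‖ ^ 2) = Real.pi * ∫ x in Ioi (0 : ℝ), F x := by
  have h := integral_fun_norm_addHaar (volume : Measure ℂ) fun y => F (y ^ 2)
  have h2 := integral_comp_rpow_Ioi_of_pos (g := F) two_pos
  rw [h, ← h2, Complex.finrank_real_complex, Measure.real, Complex.volume_ball]
  simp only [smul_eq_mul, Nat.add_one_sub_one, pow_one]
  simp
  have h3 : ∀ x : ℝ, 2 * x ^ ((2 : ℝ) - 1) * F (x ^ 2) = 2 * (x * F (x ^ 2)) := by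
    intro x
    norm_num
    ring
  simp only [h3, integral_const_mul]
  ring

lemma integrable_comp_norm_complex {F : ℝ → ℝ} (hF : IntegrableOn F (Ioi 0)) :
    Integrable fun z : ℂ => F (‖z‖ ^ 2) := by
  have h := integrable_fun_norm_addHaar (volume : Measure ℂ) (f := fun y => F (y ^ 2))
  rw [h, Complex.finrank_real_complex]
  have h2 := (integrableOn_Ioi_comp_rpow_iff' F two_ne_zero).2 hF
  norm_num at h2 ⊢
  exact h2

/-! ### The weight: moments and resolution of the identity -/

/-- The constant in front of the G-function in `ω_m`, without `x^m / N_m(x)²`. -/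
noncomputable def ptWeightConst (a l l' : ℝ) (m : ℕ) : ℝ :=
  1 / (2 * Real.pi * Real.sqrt Real.pi) * (1 / a) ^ (-(2 * (1 + 2 * (m : ℤ)))) *
    (2 : ℝ) ^ (2 * ((l + l') / 2 - 1))

lemma ptWeightConst_pos {a : ℝ} (ha : 0 < a) (l l' : ℝ) (m : ℕ) : 0 < ptWeightConst a l l' m := by
  have := Real.sqrt_pos.2 Real.pi_pos
  unfold ptWeightConst
  positivity

lemma meijerKernel_natCast {ρ : ℝ} (m n : ℕ) :
    meijerKernel [] (ptTop ρ m) (ptBottom ρ m) [] (n + m + 1) =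
      ((Real.Gamma (n + 1) ^ 2 * Real.Gamma (n + m + 2 * ρ) * Real.Gamma (n + m + ρ) *
              Real.Gamma (n + m + ρ + 1 / 2) /
            (Real.Gamma (n + m + 1) * Real.Gamma (n + 2 * m + 2 * ρ) ^ 2) : ℝ) : ℂ) := by
  simp only [meijerKernel, ptTop, ptBottom, List.map_cons, List.map_nil, List.prod_cons,
    List.prod_nil, mul_one, one_mul]
  push_cast [← Complex.Gamma_ofReal]
  rw [show (-m + (n + m + 1) : ℂ) = n + 1 by ring,
    show (2 * ρ - 1 + (n + m + 1) : ℂ) = n + m + 2 * ρ by ring,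
    show (-1 + ρ + (n + m + 1) : ℂ) = n + m + ρ by ring,
    show (-(1 / 2) + ρ + (n + m + 1) : ℂ) = n + m + ρ + 1 / 2 by ring,
    show (0 + (n + m + 1) : ℂ) = n + m + 1 by ring,
    show (-1 + 2 * ρ + m + (n + m + 1) : ℂ) = n + 2 * m + 2 * ρ by ring]
  ring

section

variable {a l l' ρ : ℝ} {m : ℕ} {H : ℝ → ℝ}

/-- The moment is the Mellin transform of `H` at `s = n+m+1`. Rescaling by `a²/4` contributes
`(4/a²)^{n+m+1}`, which combines with the prefactor of the weight to give the powers of `2` and `λ`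
in `|K_n^m|²`. -/
lemma moment_weight (ha : 0 < a) (hl : 3 / 2 ≤ l) (hl' : 3 / 2 ≤ l') (α : ℝ)
    (hρ : 2 * ρ = l + l') (hH : MellinTame H m)
    (hH' : ∀ s : ℂ, m < s.re →
      mellin (fun x => (H x : ℂ)) s = meijerKernel [] (ptTop ρ m) (ptBottom ρ m) [] s) (n : ℕ) :
    IntegrableOn (fun x => x ^ (n + m) * (ptWeightConst a l l' m * H (a ^ 2 * x / 4))) (Ioi 0) ∧
      ∫ x in Ioi 0, x ^ (n + m) * (ptWeightConst a l l' m * H (a ^ 2 * x / 4)) =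
        ‖ptK a l l' α m n‖ ^ 2 / Real.pi := by
  have hq : 0 < a ^ 2 / 4 := by positivity
  have hre : (m : ℝ) < ((n : ℂ) + m + 1).re := by
    simp only [Complex.add_re, Complex.natCast_re, Complex.one_re]
    have : (0 : ℝ) ≤ n := by positivity
    linarith
  have hcast : ∀ x ∈ Ioi (0 : ℝ), (x : ℂ) ^ ((n : ℂ) + m + 1 - 1) • (H (a ^ 2 / 4 * x) : ℂ) =
      ((x ^ (n + m) * H (a ^ 2 / 4 * x) : ℝ) : ℂ) := by
    intro x hx
    rw [add_sub_cancel_right, ← Nat.cast_add, Complex.cpow_natCast, smul_eq_mul]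
    push_cast
    ring
  have hconv := (MellinConvergent.comp_mul_left (f := fun x => (H x : ℂ)) hq).2
    (hH.mellinConvergent hre)
  have hval := mellin_comp_mul_left (fun x => (H x : ℂ)) ((n : ℂ) + m + 1) hq
  rw [MellinConvergent, integrableOn_congr_fun hcast measurableSet_Ioi] at hconv
  rw [mellin, setIntegral_congr_fun measurableSet_Ioi hcast, integral_complex_ofReal,
    hH' _ hre, meijerKernel_natCast,
    show (-((n : ℂ) + m + 1)) = -((n + m + 1 : ℕ) : ℂ) by push_cast; ring, Complex.cpow_neg,
    Complex.cpow_natCast, smul_eq_mul, ← Complex.ofReal_pow, ← Complex.ofReal_inv,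
    ← Complex.ofReal_mul, Complex.ofReal_inj] at hval
  have hform : (fun x => x ^ (n + m) * (ptWeightConst a l l' m * H (a ^ 2 * x / 4))) =
      fun x => ptWeightConst a l l' m * (x ^ (n + m) * H (a ^ 2 / 4 * x)) := by
    funext x
    rw [show a ^ 2 * x / 4 = a ^ 2 / 4 * x by ring]
    ring
  have hreal : IntegrableOn (fun x => x ^ (n + m) * H (a ^ 2 / 4 * x)) (Ioi 0) := by
    have h := hconv.re
    simpa only [IntegrableOn, RCLike.re_eq_complex_re, Complex.ofReal_re] using h
  rw [hform]
  refine ⟨hreal.const_mul _, ?_⟩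
  rw [integral_const_mul, hval, norm_sq_ptK_eq ha hl hl' α hρ, ptWeightConst, ← hρ]
  generalize Real.Gamma (n + 1) ^ 2 * Real.Gamma (n + m + 2 * ρ) * Real.Gamma (n + m + ρ) *
    Real.Gamma (n + m + ρ + 1 / 2) /
      (Real.Gamma (n + m + 1) * Real.Gamma (n + 2 * m + 2 * ρ) ^ 2) = κ
  have e1 : (2 : ℝ) ^ (2 * n + 2 * m + 2 * ρ) = 2 ^ (2 * (2 * ρ / 2 - 1)) * 4 ^ (n + m + 1) := by
    rw [show (4 : ℝ) = 2 ^ (2 : ℝ) by norm_num, ← Real.rpow_natCast, ← Real.rpow_mul two_pos.le,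
      ← Real.rpow_add two_pos]
    push_cast
    ring_nf
  have e2 : (1 / a) ^ (2 * ((n : ℤ) - m)) =
      (1 / a) ^ (-(2 * (1 + 2 * (m : ℤ)))) * ((a ^ 2) ^ (n + m + 1))⁻¹ := by
    rw [← pow_mul, ← inv_pow, ← one_div, ← zpow_natCast, ← zpow_add₀ (by positivity)]
    push_cast
    ring_nf
  have hπ := Real.sqrt_pos.2 Real.pi_pos
  rw [e1, e2, div_pow]
  field_simp

lemma ptWeight_eq (ha : 0 < a) (α : ℝ) (hρ : 2 * ρ = l + l') {c : ℝ}
    (hG : ∀ x, 0 < x → meijerG [] (ptTop ρ m) (ptBottom ρ m) [] c x = H x) {x : ℝ} (hx : 0 < x) :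
    ptWeight a l l' α m c x = ((x ^ m / ptN a l l' α m x ^ 2 *
      (ptWeightConst a l l' m * H (a ^ 2 * x / 4)) : ℝ) : ℂ) := by
  have h : (l + l') / 2 = ρ := by linarith
  rw [ptWeight, ptWeightConst, h, hG _ (by positivity)]
  push_cast
  ring

lemma ptG_eq (ha : 0 < a) (hl : 3 / 2 ≤ l) (hl' : 3 / 2 ≤ l') (α : ℝ) (hρ : 2 * ρ = l + l') {c : ℝ}
    (hG : ∀ x, 0 < x → meijerG [] (ptTop ρ m) (ptBottom ρ m) [] c x = H x) {x : ℝ} (hx : 0 < x) :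
    ptG a l l' α m c x = ((Real.pi * (ptWeightConst a l l' m * H (a ^ 2 * x / 4)) : ℝ) : ℂ) := by
  have hN := ptN_pos ha hl hl' α m hx.le
  rw [ptG, ptWeight_eq ha α hρ hG hx, ← Complex.ofReal_mul]
  congr 1
  field_simp

/-- The functions `√(ω_m) N_m z^n / K_n^m`, which are orthonormal in `L²(ℂ)`. -/
noncomputable def ptFrame (a l l' α : ℝ) (m : ℕ) (H : ℝ → ℝ) (n : ℕ) (z : ℂ) : ℂ :=
  (Real.sqrt ((‖z‖ ^ 2) ^ m * (ptWeightConst a l l' m * H (a ^ 2 * ‖z‖ ^ 2 / 4))) : ℂ) *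
    (z ^ n / ptK a l l' α m n)

lemma ptFrame_weight_nonneg (ha : 0 < a) (hH : MellinTame H m) {z : ℂ} (hz : z ≠ 0) :
    0 ≤ (‖z‖ ^ 2) ^ m * (ptWeightConst a l l' m * H (a ^ 2 * ‖z‖ ^ 2 / 4)) := by
  have h1 := ptWeightConst_pos ha l l' m
  have h2 := hH.pos (a ^ 2 * ‖z‖ ^ 2 / 4) (by positivity)
  positivity

/-- Nothing is known about `H` at `0`, so the origin is discarded as a null set. -/
lemma ae_ne_zero_complex : ∀ᵐ z : ℂ, z ≠ 0 := by
  simp [ae_iff]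

lemma aestronglyMeasurable_ptFrame (ha : 0 < a) (α : ℝ) (hH : MellinTame H m) (n : ℕ) :
    AEStronglyMeasurable (ptFrame a l l' α m H n) := by
  have h : ContinuousOn (ptFrame a l l' α m H n) {0}ᶜ := by
    refine ContinuousOn.mul (Complex.continuous_ofReal.comp_continuousOn
      (Real.continuous_sqrt.comp_continuousOn (ContinuousOn.mul (by fun_prop)
        (continuousOn_const.mul (hH.continuousOn.comp (by fun_prop) fun z hz => ?_))))) (by fun_prop)
    have : z ≠ 0 := hz
    exact (by positivity : 0 < a ^ 2 * ‖z‖ ^ 2 / 4)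
  have h2 := h.aestronglyMeasurable (μ := volume) (measurableSet_singleton (0 : ℂ)).compl
  rwa [restrict_compl_singleton] at h2

lemma norm_sq_ptFrame (ha : 0 < a) (α : ℝ) (hH : MellinTame H m) (n : ℕ) {z : ℂ} (hz : z ≠ 0) :
    ‖ptFrame a l l' α m H n z‖ ^ 2 = (‖ptK a l l' α m n‖ ^ 2)⁻¹ *
      ((‖z‖ ^ 2) ^ (n + m) * (ptWeightConst a l l' m * H (a ^ 2 * ‖z‖ ^ 2 / 4))) := by
  rw [ptFrame, norm_mul, mul_pow, Complex.norm_real, Real.norm_eq_abs, sq_abs,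
    Real.sq_sqrt (ptFrame_weight_nonneg ha hH hz), norm_sq_pow_div_ptK]
  ring

lemma memLp_ptFrame (ha : 0 < a) (hl : 3 / 2 ≤ l) (hl' : 3 / 2 ≤ l') (α : ℝ)
    (hρ : 2 * ρ = l + l') (hH : MellinTame H m)
    (hH' : ∀ s : ℂ, m < s.re →
      mellin (fun x => (H x : ℂ)) s = meijerKernel [] (ptTop ρ m) (ptBottom ρ m) [] s) (n : ℕ) :
    MemLp (ptFrame a l l' α m H n) 2 := by
  rw [memLp_two_iff_integrable_sq_norm (aestronglyMeasurable_ptFrame ha α hH n)]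
  refine ((integrable_comp_norm_complex (moment_weight ha hl hl' α hρ hH hH' n).1).const_mul
    (‖ptK a l l' α m n‖ ^ 2)⁻¹).congr ?_
  filter_upwards [ae_ne_zero_complex] with z hz
  exact (norm_sq_ptFrame ha α hH n hz).symm

lemma orthonormal_ptFrame (ha : 0 < a) (hl : 3 / 2 ≤ l) (hl' : 3 / 2 ≤ l') (α : ℝ)
    (hρ : 2 * ρ = l + l') (hH : MellinTame H m)
    (hH' : ∀ s : ℂ, m < s.re →
      mellin (fun x => (H x : ℂ)) s = meijerKernel [] (ptTop ρ m) (ptBottom ρ m) [] s) :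
    Orthonormal ℂ fun n =>
      (memLp_ptFrame ha hl hl' α hρ hH hH' n).toLp (ptFrame a l l' α m H n) := by
  rw [orthonormal_iff_ite]
  intro n k
  have h : ⟪(memLp_ptFrame ha hl hl' α hρ hH hH' n).toLp (ptFrame a l l' α m H n),
      (memLp_ptFrame ha hl hl' α hρ hH hH' k).toLp (ptFrame a l l' α m H k)⟫_ℂ =
      ∫ z : ℂ, (starRingEnd ℂ) (ptFrame a l l' α m H n z) * ptFrame a l l' α m H k z := by
    rw [L2.inner_def]
    refine integral_congr_ae ?_
    filter_upwards [(memLp_ptFrame ha hl hl' α hρ hH hH' n).coeFn_toLp,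
      (memLp_ptFrame ha hl hl' α hρ hH hH' k).coeFn_toLp] with z h1 h2
    rw [h1, h2]
    exact mul_comm _ _
  rw [h]
  split_ifs with hnk
  · subst hnk
    have h1 : ∀ᵐ z : ℂ, (starRingEnd ℂ) (ptFrame a l l' α m H n z) * ptFrame a l l' α m H n z =
        (((‖ptK a l l' α m n‖ ^ 2)⁻¹ *
          ((‖z‖ ^ 2) ^ (n + m) * (ptWeightConst a l l' m * H (a ^ 2 * ‖z‖ ^ 2 / 4))) : ℝ) : ℂ) := by
      filter_upwards [ae_ne_zero_complex] with z hz
      rw [← norm_sq_ptFrame ha α hH n hz, ← Complex.normSq_eq_conj_mul_self,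
        Complex.normSq_eq_norm_sq]
    rw [integral_congr_ae h1, integral_complex_ofReal, integral_const_mul,
      integral_comp_norm_complex fun x =>
        x ^ (n + m) * (ptWeightConst a l l' m * H (a ^ 2 * x / 4)),
      (moment_weight ha hl hl' α hρ hH hH' n).2]
    have h2 := norm_sq_ptK_pos ha hl hl' α m n
    rw [mul_div_cancel₀ _ Real.pi_pos.ne', inv_mul_cancel₀ h2.ne', Complex.ofReal_one]
  · have h1 : ∀ z : ℂ, (starRingEnd ℂ) (ptFrame a l l' α m H n z) * ptFrame a l l' α m H k z =
        ((Real.sqrt ((‖z‖ ^ 2) ^ m * (ptWeightConst a l l' m * H (a ^ 2 * ‖z‖ ^ 2 / 4))) : ℂ) ^ 2 *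
          ((starRingEnd ℂ) (ptK a l l' α m n) * ptK a l l' α m k)⁻¹) *
          ((starRingEnd ℂ) z ^ n * z ^ k) := by
      intro z
      simp only [ptFrame, map_mul, map_inv₀, map_pow, Complex.conj_ofReal, mul_inv, div_eq_mul_inv]
      ring
    simp only [h1]
    exact integral_radial_mul_conj_pow_mul_pow (fun r =>
      (Real.sqrt ((r ^ 2) ^ m * (ptWeightConst a l l' m * H (a ^ 2 * r ^ 2 / 4))) : ℂ) ^ 2 *
          ((starRingEnd ℂ) (ptK a l l' α m n) * ptK a l l' α m k)⁻¹) hnk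

lemma hasSum_ptFrame (ha : 0 < a) (hl : 3 / 2 ≤ l) (hl' : 3 / 2 ≤ l') (α : ℝ) (m : ℕ) (H : ℝ → ℝ)
    (f : PTHilbert a) (z : ℂ) :
    HasSum (fun n => ⟪f, ptState ha hl hl' (n + m)⟫_ℂ * ptFrame a l l' α m H n z)
      ((Real.sqrt ((‖z‖ ^ 2) ^ m * (ptWeightConst a l l' m * H (a ^ 2 * ‖z‖ ^ 2 / 4))) : ℂ) *
        ((ptN a l l' α m (‖z‖ ^ 2) : ℂ)⁻¹ * ⟪f, ptCoherent ha hl hl' α m z⟫_ℂ)) := by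
  have h := ((orthonormal_ptState_add ha hl hl' m).hasSum_inner_tsum_smul
    (summable_norm_sq_pow_div_ptK ha hl hl' α m z) f).mul_left (Real.sqrt ((‖z‖ ^ 2) ^ m *
      (ptWeightConst a l l' m * H (a ^ 2 * ‖z‖ ^ 2 / 4))) : ℂ)
  have hN := ptN_pos ha hl hl' α m (sq_nonneg ‖z‖)
  have hN' : (ptN a l l' α m (‖z‖ ^ 2) : ℂ) ≠ 0 := by exact_mod_cast hN.ne'
  rw [ptCoherent, inner_smul_right, inv_mul_cancel_left₀ hN']
  have hterm : (fun n => ⟪f, ptState ha hl hl' (n + m)⟫_ℂ * ptFrame a l l' α m H n z) = fun n =>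
      (Real.sqrt ((‖z‖ ^ 2) ^ m * (ptWeightConst a l l' m * H (a ^ 2 * ‖z‖ ^ 2 / 4))) : ℂ) *
        (⟪f, ptState ha hl hl' (n + m)⟫_ℂ * (z ^ n / ptK a l l' α m n)) := by
    funext n
    rw [ptFrame]
    ring
  rwa [hterm]

lemma ptCoherent_resolution (ha : 0 < a) (hl : 3 / 2 ≤ l) (hl' : 3 / 2 ≤ l') (α : ℝ)
    (hρ : 2 * ρ = l + l') (hH : MellinTame H m)
    (hH' : ∀ s : ℂ, m < s.re →
      mellin (fun x => (H x : ℂ)) s = meijerKernel [] (ptTop ρ m) (ptBottom ρ m) [] s) {c : ℝ}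
    (hG : ∀ x, 0 < x → meijerG [] (ptTop ρ m) (ptBottom ρ m) [] c x = H x) (f g : PTHilbert a) :
    Integrable (fun z : ℂ => ptWeight a l l' α m c (‖z‖ ^ 2) *
        (⟪f, ptCoherent ha hl hl' α m z⟫_ℂ * ⟪ptCoherent ha hl hl' α m z, g⟫_ℂ)) ∧
      ∫ z : ℂ, ptWeight a l l' α m c (‖z‖ ^ 2) *
        (⟪f, ptCoherent ha hl hl' α m z⟫_ℂ * ⟪ptCoherent ha hl hl' α m z, g⟫_ℂ) =
      ⟪f, (ptSubspace ha hl hl' m).starProjection g⟫_ℂ := by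
  have hort := orthonormal_ptState_add ha hl hl' m
  have hsum : ∀ f : PTHilbert a, Summable fun n => ‖⟪f, ptState ha hl hl' (n + m)⟫_ℂ‖ ^ 2 := by
    intro f
    simpa only [norm_inner_symm f] using Orthonormal.inner_products_summable f hort
  obtain ⟨h1, h2⟩ := integral_mul_conj_of_hasSum _ (orthonormal_ptFrame ha hl hl' α hρ hH hH')
    (hsum f) (hsum g) (Filter.Eventually.of_forall (hasSum_ptFrame ha hl hl' α m H f))
    (Filter.Eventually.of_forall (hasSum_ptFrame ha hl hl' α m H g))
  have hae : ∀ᵐ z : ℂ,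
      ((Real.sqrt ((‖z‖ ^ 2) ^ m * (ptWeightConst a l l' m * H (a ^ 2 * ‖z‖ ^ 2 / 4))) : ℂ) *
        ((ptN a l l' α m (‖z‖ ^ 2) : ℂ)⁻¹ * ⟪f, ptCoherent ha hl hl' α m z⟫_ℂ)) * (starRingEnd ℂ)
      ((Real.sqrt ((‖z‖ ^ 2) ^ m * (ptWeightConst a l l' m * H (a ^ 2 * ‖z‖ ^ 2 / 4))) : ℂ) *
        ((ptN a l l' α m (‖z‖ ^ 2) : ℂ)⁻¹ * ⟪g, ptCoherent ha hl hl' α m z⟫_ℂ)) =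
      ptWeight a l l' α m c (‖z‖ ^ 2) *
        (⟪f, ptCoherent ha hl hl' α m z⟫_ℂ * ⟪ptCoherent ha hl hl' α m z, g⟫_ℂ) := by
    filter_upwards [ae_ne_zero_complex] with z hz
    have hw := Real.mul_self_sqrt (ptFrame_weight_nonneg (l := l) (l' := l') ha hH hz)
    set w := Real.sqrt ((‖z‖ ^ 2) ^ m * (ptWeightConst a l l' m * H (a ^ 2 * ‖z‖ ^ 2 / 4)))
    rw [ptWeight_eq ha α hρ hG (by positivity), div_mul_eq_mul_div, ← hw]
    simp only [map_mul, Complex.conj_ofReal, map_inv₀, inner_conj_symm]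
    push_cast
    ring
  refine ⟨h1.congr hae, ?_⟩
  rw [← integral_congr_ae hae]
  -- Parseval in `L²(ℂ)` and the expansion of `⟨f, P_m g⟩` produce the same series, so the sums
  -- coincide.
  refine h2.unique ?_
  simp only [inner_conj_symm]
  have : (Submodule.span ℂ (range fun n : ℕ =>
      ptState ha hl hl' (n + m))).topologicalClosure.HasOrthogonalProjection :=
    inferInstanceAs (ptSubspace ha hl hl' m).HasOrthogonalProjection
  exact hort.hasSum_inner_mul_inner_starProjection f g

end

theorem mainTheorem2 (a l l' α : ℝ) (ha : 0 < a) (hl : 3 / 2 ≤ l) (hl' : 3 / 2 ≤ l')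
    (ρ : ℝ) (hρ : 2 * ρ = l + l') (m : ℕ) (c : ℝ)
    (hc : MeijerSeparates [] (ptBottom ρ m) c) :
    -- the eigenstates are orthonormal; the coherent states are well-defined unit vectors of `𝔥_m`
    Orthonormal ℂ (fun n : ℕ => ptState ha hl hl' n) ∧
    (∀ z : ℂ,
      Summable (fun n : ℕ => (‖z‖ ^ 2) ^ n / ‖ptK a l l' α m n‖ ^ 2) ∧
      Summable (fun n : ℕ => (z ^ n / ptK a l l' α m n) • ptState ha hl hl' (n + m)) ∧
      ‖ptCoherent ha hl hl' α m z‖ = 1 ∧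
      ptCoherent ha hl hl' α m z ∈ ptSubspace ha hl hl' m) ∧
    -- the integral that defines the G-function converges absolutely
    Complex.VerticalIntegrable (meijerKernel [] (ptTop ρ m) (ptBottom ρ m) []) c ∧
    -- the weight is real and positive
    (∀ x : ℝ, 0 < x → (ptWeight a l l' α m c x).im = 0 ∧ 0 < (ptWeight a l l' α m c x).re) ∧
    -- the Stieltjes moment problem
    (∀ n : ℕ,
      IntegrableOn (fun x : ℝ => (x : ℂ) ^ (n + m) * ptG a l l' α m c x) (Ioi 0) ∧
      ∫ x in Ioi (0 : ℝ), (x : ℂ) ^ (n + m) * ptG a l l' α m c x =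
        ((‖ptK a l l' α m n‖ ^ 2 : ℝ) : ℂ) ∧
      ‖ptK a l l' α m n‖ ^ 2 =
        (1 / a) ^ (2 * ((n : ℤ) - m)) * ((2 : ℝ) ^ (2 * n + 2 * m + 2 * ρ) /
            (2 * Real.sqrt Real.pi)) *
          (Real.Gamma (n + 1) ^ 2 * Real.Gamma (n + m + 2 * ρ) * Real.Gamma (n + m + ρ) *
              Real.Gamma (n + m + ρ + 1 / 2) /
            (Real.Gamma (n + m + 1) * Real.Gamma (n + 2 * m + 2 * ρ) ^ 2))) ∧
    -- the resolution of the identity of `𝔥_m`, in the weak sense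
    (∀ f g : PTHilbert a,
      Integrable (fun z : ℂ => ptWeight a l l' α m c (‖z‖ ^ 2) *
        (⟪f, ptCoherent ha hl hl' α m z⟫_ℂ * ⟪ptCoherent ha hl hl' α m z, g⟫_ℂ)) ∧
      ∫ z : ℂ, ptWeight a l l' α m c (‖z‖ ^ 2) *
        (⟪f, ptCoherent ha hl hl' α m z⟫_ℂ * ⟪ptCoherent ha hl hl' α m z, g⟫_ℂ) =
      ⟪f, (ptSubspace ha hl hl' m).starProjection g⟫_ℂ) := by
  have hρ' : 3 / 2 ≤ ρ := by linarith
  -- The lower parameter `-m` has the rightmost pole; the others are positive since `ρ ≥ 3/2`, so `c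
  -- > m` is the whole condition.
  have hmc : (m : ℝ) < c := by simpa using hc.1 (-m) (by simp [ptBottom])
  obtain ⟨H, hH, hH'⟩ := exists_mellin_eq_meijerKernel hρ' m
  have hG : ∀ x, 0 < x → meijerG [] (ptTop ρ m) (ptBottom ρ m) [] c x = H x :=
    fun x hx => meijerG_eq hρ' hH hH' hmc hx
  refine ⟨orthonormal_ptState ha hl hl', fun z => ⟨?_, summable_smul_ptState ha hl hl' α m z,
    norm_ptCoherent ha hl hl' α m z, ptCoherent_mem ha hl hl' α m z⟩,
    verticalIntegrable_meijerKernel hρ' m hmc, fun x hx => ?_, fun n => ?_,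
    ptCoherent_resolution ha hl hl' α hρ hH hH' hG⟩
  · exact summable_pow_div_norm_sq_ptK ha hl hl' α m (sq_nonneg _)
  · have h1 := ptN_pos ha hl hl' α m hx.le
    have h2 := ptWeightConst_pos ha l l' m
    have h3 := hH.pos (a ^ 2 * x / 4) (by positivity)
    rw [ptWeight_eq ha α hρ hG hx, Complex.ofReal_im, Complex.ofReal_re]
    exact ⟨rfl, by positivity⟩
  · obtain ⟨h1, h2⟩ := moment_weight ha hl hl' α hρ hH hH' n
    have h3 : ∀ x ∈ Ioi (0 : ℝ), (x : ℂ) ^ (n + m) * ptG a l l' α m c x = ((Real.pi *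
        (x ^ (n + m) * (ptWeightConst a l l' m * H (a ^ 2 * x / 4))) : ℝ) : ℂ) := by
      intro x hx
      rw [ptG_eq ha hl hl' α hρ hG hx]
      push_cast
      ring
    refine ⟨?_, ?_, norm_sq_ptK_eq ha hl hl' α hρ m n⟩
    · rw [integrableOn_congr_fun h3 measurableSet_Ioi]
      exact (h1.const_mul _).ofReal
    · rw [setIntegral_congr_fun measurableSet_Ioi h3, integral_complex_ofReal, integral_const_mul,
        h2, mul_div_cancel₀ _ Real.pi_pos.ne']
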